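/- Let $a>0$, $b>0$, $E>0$ and, for $\gamma\in\mathbb R$, consider the planar system $$\psi'=v,\qquad v'=2\bigl(\gamma+a\psi^2-b\psi^4\bigr)v-2E\psi ,$$ with Jacobian $J(\gamma)$ at the equilibrium $(0,0)$. Then, for every $\gamma\in\mathbb R$, $$J(\gamma)=\begin{pmatrix}0&1\\-2E&2\gamma\end{pmatrix},\qquad \operatorname{tr}J(\gamma)=2\gamma,\qquad \det J(\gamma)=2E>0,$$ and $\partial_\gamma(\operatorname{tr}J)|_{\gamma=0}=2\neq0$. Moreover, the equilibrium $(0,0)$ undergoes a Hopf bifurcation at $\gamma=0$ with linear frequency $\omega=\sqrt{2E}$. Here a smooth one-parameter family of planar systems $u'=f_p(u)$ is said to undergo a Hopf bifurcation at the point $x_0$ and the parameter value $p_0$, with linear frequency $\omega>0$, if $f_p(x_0)=0$ for all $p$ near $p_0$ and the following hold. 1. The eigenvalues of $Df_{p_0}(x_0)$ are the simple pair $\pm i\omega$, and there is a $C^1$ function $p\mapsto\lambda(p)$ near $p_0$ with $\lambda(p)$ an eigenvalue of $Df_p(x_0)$, $\lambda(p_0)=i\omega$ and $\frac{d}{dp}\operatorname{Re}\lambda(p)\big|_{p=p_0}\neq0$.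 2. For $p$ close to $p_0$, $x_0$ is locally asymptotically stable for $p$ on one side of $p_0$, and repelling (that is, locally asymptotically stable for the time-reversed system) for $p$ on the other side. 3. Periodic orbits emanate from $x_0$: there are $\varepsilon_0>0$, continuous functions $\mu,T:[0,\varepsilon_0)\to\mathbb R$ and $\xi:[0,\varepsilon_0)\to\mathbb R^2$ with $\mu(0)=p_0$, $T(0)=2\pi/\omega$, $\xi(0)=x_0$ such that for each $0<\varepsilon<\varepsilon_0$ the solution of $u'=f_{\mu(\varepsilon)}(u)$ with $u(0)=\xi(\varepsilon)$ is a nonconstant periodic solution with minimal period $T(\varepsilon)$; these orbits shrink to $x_0$ as $\varepsilon\to0^+$; and there are $r,\delta>0$ such that every nonconstant periodic orbit of $u'=f_p(u)$ with $|p-p_0|<\delta$ that stays in the ball of radius $r$ around $x_0$ is one of them (with $\mu(\varepsilon)=p$). -/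

import Mathlib

open Filter Set
open scoped Topology

/-- The amplitude-dependent non-Hermitian coefficient `F(z) = γ + a z - b z²`. -/
def nonreciprocity (γ a b z : ℝ) : ℝ := γ + a * z - b * z ^ 2

/-- The planar vector field `(ψ, v) ↦ (v, 2 F(ψ²) v - 2 E ψ)`; `u 0 = ψ` and `u 1 = v`. -/
def phaseField (a b E γ : ℝ) (u : Fin 2 → ℝ) : Fin 2 → ℝ :=
  ![u 1, 2 * nonreciprocity γ a b (u 0 ^ 2) * u 1 - 2 * E * u 0]

/-- The Jacobian matrix of a planar vector field at a point. -/
noncomputable def jacobian (f : (Fin 2 → ℝ) → (Fin 2 → ℝ)) (x : Fin 2 → ℝ) :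
    Matrix (Fin 2) (Fin 2) ℝ :=
  LinearMap.toMatrix' (fderiv ℝ f x : (Fin 2 → ℝ) →ₗ[ℝ] (Fin 2 → ℝ))

/-- The complex eigenvalues of a real matrix, with algebraic multiplicity. -/
noncomputable def complexEigenvalues (A : Matrix (Fin 2) (Fin 2) ℝ) : Multiset ℂ :=
  (A.map (algebraMap ℝ ℂ)).charpoly.roots

/-- Lyapunov stability of the point `x₀` for `u' = f u`: solutions that start close to `x₀` stay
close to `x₀` for as long as they exist in forward time. -/
def IsLyapunovStable (f : (Fin 2 → ℝ) → (Fin 2 → ℝ)) (x₀ : Fin 2 → ℝ) : Prop :=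
  ∀ ε > 0, ∃ δ > 0, ∀ (τ : ℝ) (y : ℝ → Fin 2 → ℝ),
    IsIntegralCurveOn y (fun _ => f) (Icc 0 τ) → dist (y 0) x₀ < δ →
      ∀ t ∈ Icc 0 τ, dist (y t) x₀ < ε

/-- (Local) asymptotic stability: Lyapunov stability together with attraction of all solutions that
start close to `x₀`. For a `C¹` field, Lyapunov stability makes the solutions that start close to
`x₀` exist for all forward time. -/
def IsAsymptoticallyStable (f : (Fin 2 → ℝ) → (Fin 2 → ℝ)) (x₀ : Fin 2 → ℝ) : Prop :=
  IsLyapunovStable f x₀ ∧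
    ∃ δ > 0, ∀ y : ℝ → Fin 2 → ℝ,
      IsIntegralCurveOn y (fun _ => f) (Ici 0) → dist (y 0) x₀ < δ →
        Tendsto y atTop (𝓝 x₀)

/-- A repelling point: it is asymptotically stable for the time-reversed equation `u' = - f u`. -/
def IsRepelling (f : (Fin 2 → ℝ) → (Fin 2 → ℝ)) (x₀ : Fin 2 → ℝ) : Prop :=
  IsAsymptoticallyStable (fun u => -f u) x₀

/-- The smooth one-parameter family of planar equations `u' = f p u` undergoes a Hopf bifurcation
at the equilibrium `x₀`, at the parameter value `p₀`, with linear frequency `ω`. -/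
structure IsHopfBifurcation (f : ℝ → (Fin 2 → ℝ) → (Fin 2 → ℝ)) (p₀ : ℝ) (x₀ : Fin 2 → ℝ)
    (ω : ℝ) : Prop where
  smooth : ContDiff ℝ (⊤ : ℕ∞) (fun q : ℝ × (Fin 2 → ℝ) => f q.1 q.2)
  equilibrium : ∀ᶠ p in 𝓝 p₀, f p x₀ = 0
  frequency_pos : 0 < ω
  /-- At `p₀` the linearization has the simple eigenvalues `± i ω`. -/
  eigenvalues : complexEigenvalues (jacobian (f p₀) x₀) = {Complex.I * ω, -(Complex.I * ω)}
  /-- The continuation of the eigenvalue `i ω` crosses the imaginary axis with nonzero speed. -/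
  transversality : ∃ (l : ℝ → ℂ) (c : ℝ), ContDiffAt ℝ 1 l p₀ ∧ l p₀ = Complex.I * ω ∧
    (∀ᶠ p in 𝓝 p₀, l p ∈ complexEigenvalues (jacobian (f p) x₀)) ∧
    HasDerivAt (fun p => (l p).re) c p₀ ∧ c ≠ 0
  /-- The equilibrium changes from attracting to repelling, or conversely. -/
  stability_exchange :
    ((∀ᶠ p in 𝓝[<] p₀, IsAsymptoticallyStable (f p) x₀) ∧
      (∀ᶠ p in 𝓝[>] p₀, IsRepelling (f p) x₀)) ∨
    ((∀ᶠ p in 𝓝[<] p₀, IsRepelling (f p) x₀) ∧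
      (∀ᶠ p in 𝓝[>] p₀, IsAsymptoticallyStable (f p) x₀))
  /-- A one-parameter family of periodic orbits `Y ε`, at the parameter value `μ ε` and with minimal
  period `T ε`, emanates from `x₀` at `p₀` with limiting period `2π / ω`, and it exhausts the
  periodic orbits close to `x₀` at parameter values close to `p₀`. -/
  periodic_orbits : ∃ (ε₀ : ℝ) (μ T : ℝ → ℝ) (Y : ℝ → ℝ → Fin 2 → ℝ),
    0 < ε₀ ∧
    ContinuousOn μ (Ico 0 ε₀) ∧ ContinuousOn T (Ico 0 ε₀) ∧
    ContinuousOn (fun ε => Y ε 0) (Ico 0 ε₀) ∧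
    μ 0 = p₀ ∧ T 0 = 2 * Real.pi / ω ∧ Y 0 0 = x₀ ∧
    (∀ ε ∈ Ioo 0 ε₀, IsIntegralCurve (Y ε) (fun _ => f (μ ε)) ∧
      IsLeast {τ : ℝ | 0 < τ ∧ Function.Periodic (Y ε) τ} (T ε)) ∧
    (∀ r > 0, ∀ᶠ ε in 𝓝[>] (0 : ℝ), ∀ t, dist (Y ε t) x₀ < r) ∧
    ∃ r > 0, ∃ δ > 0, ∀ (p : ℝ) (y : ℝ → Fin 2 → ℝ),
      |p - p₀| < δ → IsIntegralCurve y (fun _ => f p) →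
      (∃ τ > 0, Function.Periodic y τ) → (¬ ∃ x, ∀ t, y t = x) →
      (∀ t, dist (y t) x₀ < r) →
        ∃ ε ∈ Ioo 0 ε₀, μ ε = p ∧ Y ε 0 ∈ range y

/-!
The linearization at the origin has trace `2 γ` and a positive determinant `k = w ^ 2`, which gives
the eigenvalues, their crossing of the imaginary axis and, through a quadratic Lyapunov function,
the exchange of stability.

For the periodic orbits, write `ψ - i v / w = exp (R + i θ)`. Then `θ` increases near the
equilibrium, and `R` as a function of `θ` solves a scalar equation with `2π`-periodic coefficients.
The logarithmic displacement `σ = R - log x`, where `x` is the initial radius, satisfies an equation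
that extends continuously to `x = 0`: this blows the equilibrium up to a circle. The displacement
after one turn is strictly increasing in `γ`, also at `x = 0`, and changes sign, so it vanishes at
exactly one value `γ = μ x`, which depends continuously on `x`. A periodic orbit that closes up
after several turns closes up after one, because the displacement along it keeps its sign.
-/

section ScalarCalculus

lemma nonneg_of_neg_mul_abs_le_deriv {u u' : ℝ → ℝ} {K a b : ℝ}
    (hu : ∀ t ∈ Icc a b, HasDerivAt u (u' t) t) (hK : ∀ t ∈ Icc a b, -(K * |u t|) ≤ u' t)
    (ha : 0 ≤ u a) : ∀ t ∈ Icc a b, 0 ≤ u t := by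
  intro t ht
  have barrier : ∀ ε > 0, -u t ≤ ε * Real.exp ((K + 1) * t) := by
    intro ε hε
    have hB (s : ℝ) : HasDerivAt (fun s => ε * Real.exp ((K + 1) * s))
        ((K + 1) * (ε * Real.exp ((K + 1) * s))) s :=
      ((((hasDerivAt_id' s).const_mul (K + 1)).exp).const_mul ε).congr_deriv (by ring)
    refine image_le_of_deriv_right_lt_deriv_boundary (f := fun s => -u s)
      (f' := fun s => -u' s)
      (fun s hs => (hu s hs).neg.continuousAt.continuousWithinAt)
      (fun s hs => (hu s (Ico_subset_Icc_self hs)).neg.hasDerivWithinAt)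
      (le_trans (by simpa using ha) (by positivity : (0 : ℝ) ≤ _)) hB (fun s hs hus => ?_) ht
    have hpos : 0 < ε * Real.exp ((K + 1) * s) := by positivity
    have habs : |u s| = ε * Real.exp ((K + 1) * s) := by rw [← abs_neg, hus, abs_of_pos hpos]
    have := hK s (Ico_subset_Icc_self hs)
    rw [habs] at this
    linarith
  have tendsto_barrier :
      Tendsto (fun ε => ε * Real.exp ((K + 1) * t)) (𝓝[>] 0) (𝓝 0) :=
    ((continuous_id.mul continuous_const).tendsto' 0 0 (zero_mul _)).mono_left nhdsWithin_le_nhds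
  exact neg_nonpos.1 (ge_of_tendsto tendsto_barrier (eventually_mem_nhdsWithin.mono barrier))

lemma pos_of_neg_mul_abs_le_deriv {u u' : ℝ → ℝ} {K a b c : ℝ}
    (hu : ∀ t ∈ Icc a b, HasDerivAt u (u' t) t) (hK : ∀ t ∈ Icc a b, -(K * |u t|) ≤ u' t)
    (ha : 0 ≤ u a) (hc : c ∈ Ioo a b) (hcK : -(K * |u c|) < u' c) : 0 < u b := by
  have nonneg := nonneg_of_neg_mul_abs_le_deriv hu hK ha
  have hab : a ≤ b := (hc.1.trans hc.2).le
  refine (nonneg b ⟨hab, le_rfl⟩).lt_of_ne fun hb => ?_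
  have mono : MonotoneOn (fun t => Real.exp (K * t) * u t) (Icc a b) := by
    have hderiv (t : ℝ) (ht : t ∈ Icc a b) : HasDerivAt (fun t => Real.exp (K * t) * u t)
        (Real.exp (K * t) * (K * u t + u' t)) t :=
      (((hasDerivAt_id' t).const_mul K).exp.mul (hu t ht)).congr_deriv (by ring)
    refine monotoneOn_of_hasDerivWithinAt_nonneg (convex_Icc a b)
      (fun t ht => (hderiv t ht).continuousAt.continuousWithinAt)
      (fun t ht => (hderiv t (interior_subset ht)).hasDerivWithinAt) fun t ht => ?_
    have := hK t (interior_subset ht)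
    rw [abs_of_nonneg (nonneg t (interior_subset ht))] at this
    exact mul_nonneg (Real.exp_pos _).le (by linarith)
  have vanishes : ∀ t ∈ Icc a b, u t = 0 := by
    intro t ht
    have := mono ht ⟨hab, le_rfl⟩ ht.2
    simp only [← hb, mul_zero] at this
    exact le_antisymm (nonpos_of_mul_nonpos_right this (Real.exp_pos _)) (nonneg t ht)
  have hu0 : u =ᶠ[𝓝 c] fun _ => 0 := eventually_of_mem (Icc_mem_nhds hc.1 hc.2) vanishes
  have hc' := Ioo_subset_Icc_self hc
  rw [(hu c hc').unique ((hasDerivAt_const c 0).congr_of_eventuallyEq hu0), vanishes c hc'] at hcK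
  simp at hcK

lemma exists_inverse_hasDerivAt {f f' : ℝ → ℝ} {c : ℝ} (hc : 0 < c)
    (hf : ∀ t, HasDerivAt f (f' t) t) (hcf : ∀ t, c ≤ f' t) :
    ∃ g : ℝ → ℝ, (∀ t, g (f t) = t) ∧ (∀ s, f (g s) = s) ∧
      ∀ s, HasDerivAt g (f' (g s))⁻¹ s := by
  have strictMono : StrictMono f :=
    strictMono_of_hasDerivAt_pos hf fun t => hc.trans_le (hcf t)
  have growth : Monotone fun t => f t - c * t :=
    monotone_of_hasDerivAt_nonneg
      (fun t => (hf t).sub ((hasDerivAt_id' t).const_mul c)) fun t => by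
        simpa using hcf t
  have tendsto_atTop : Tendsto f atTop atTop := by
    refine tendsto_atTop_mono' _ ((eventually_ge_atTop 0).mono fun t ht => ?_)
      (tendsto_atTop_add_const_right _ (f 0) (tendsto_id.const_mul_atTop hc))
    have := growth ht
    simp only [id_eq, mul_zero, sub_zero] at this ⊢
    linarith
  have tendsto_atBot : Tendsto f atBot atBot := by
    refine tendsto_atBot_mono' _ ((eventually_le_atBot 0).mono fun t ht => ?_)
      (tendsto_atBot_add_const_right _ (f 0) (tendsto_id.const_mul_atBot hc))
    have := growth ht
    simp only [id_eq, mul_zero, sub_zero] at this ⊢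
    linarith
  have continuous : Continuous f :=
    continuous_iff_continuousAt.2 fun t => (hf t).continuousAt
  let e := strictMono.orderIsoOfSurjective f (continuous.surjective tendsto_atTop tendsto_atBot)
  exact ⟨e.symm, e.symm_apply_apply, e.apply_symm_apply, fun s =>
    (hf _).of_local_left_inverse e.symm.continuous.continuousAt (hc.trans_le (hcf _)).ne'
      (Eventually.of_forall e.apply_symm_apply)⟩

lemma exists_continuousOn_zero_of_strictMonoOn {X : Type*} [TopologicalSpace X] {s : Set X}
    {F : X → ℝ → ℝ} {c d : ℝ} (hcd : c ≤ d) (hX : ∀ γ ∈ Icc c d, ContinuousOn (F · γ) s)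
    (hγ : ∀ x ∈ s, ContinuousOn (F x) (Icc c d)) (hmono : ∀ x ∈ s, StrictMonoOn (F x) (Icc c d))
    (hc : ∀ x ∈ s, F x c < 0) (hd : ∀ x ∈ s, 0 < F x d) :
    ∃ μ : X → ℝ, ContinuousOn μ s ∧ ∀ x ∈ s, μ x ∈ Ioo c d ∧ F x (μ x) = 0 := by
  have hzero (x : X) : ∃ γ, x ∈ s → γ ∈ Ioo c d ∧ F x γ = 0 := by
    by_cases hx : x ∈ s
    · obtain ⟨γ, hγcd, hγ0⟩ := intermediate_value_Ioo hcd (hγ x hx) ⟨hc x hx, hd x hx⟩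
      exact ⟨γ, fun _ => ⟨hγcd, hγ0⟩⟩
    · exact ⟨c, fun h => absurd h hx⟩
  choose μ hμ using hzero
  refine ⟨μ, fun x hx => tendsto_order.2 ⟨fun γ hγμ => ?_, fun γ hγμ => ?_⟩, hμ⟩
  · rcases lt_or_ge γ c with hγc | hγc
    · filter_upwards [self_mem_nhdsWithin] with y hy using hγc.trans (hμ y hy).1.1
    have hγcd : γ ∈ Icc c d := ⟨hγc, (hγμ.trans (hμ x hx).1.2).le⟩
    have hneg : F x γ < 0 :=
      (hmono x hx hγcd (Ioo_subset_Icc_self (hμ x hx).1) hγμ).trans_eq (hμ x hx).2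
    filter_upwards [self_mem_nhdsWithin, (hX γ hγcd x hx).eventually_lt_const hneg] with y hy hFy
    rw [← (hμ y hy).2] at hFy
    exact ((hmono y hy).lt_iff_lt hγcd (Ioo_subset_Icc_self (hμ y hy).1)).1 hFy
  · rcases lt_or_ge d γ with hγd | hγd
    · filter_upwards [self_mem_nhdsWithin] with y hy using (hμ y hy).1.2.trans hγd
    have hγcd : γ ∈ Icc c d := ⟨((hμ x hx).1.1.trans hγμ).le, hγd⟩
    have hpos : 0 < F x γ :=
      (hμ x hx).2.symm.trans_lt (hmono x hx (Ioo_subset_Icc_self (hμ x hx).1) hγcd hγμ)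
    filter_upwards [self_mem_nhdsWithin, (hX γ hγcd x hx).eventually_const_lt hpos] with y hy hFy
    rw [← (hμ y hy).2] at hFy
    exact ((hmono y hy).lt_iff_lt (Ioo_subset_Icc_self (hμ y hy).1) hγcd).1 hFy

end ScalarCalculus

section IntegralCurves

open NNReal

variable {E : Type*} [NormedAddCommGroup E] [NormedSpace ℝ E]

lemma integralCurve_eq_of_lipschitz {v : ℝ → E → E} {K : ℝ≥0} (hv : ∀ t, LipschitzWith K (v t))
    {y z : ℝ → E} (hy : IsIntegralCurve y v) (hz : IsIntegralCurve z v) {t₀ : ℝ}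
    (h : y t₀ = z t₀) : y = z :=
  ODE_solution_unique_univ (s := fun _ => univ) (fun t => (hv t).lipschitzOnWith)
    (fun t => ⟨hy t, mem_univ _⟩) (fun t => ⟨hz t, mem_univ _⟩) h

lemma exists_isIntegralCurve_of_forall_Ioo {v : ℝ → E → E} {K : ℝ≥0}
    (hv : ∀ t, LipschitzWith K (v t)) {x : E}
    (h : ∀ n : ℕ, ∃ y : ℝ → E, y 0 = x ∧ ∀ t ∈ Ioo (-n : ℝ) n, HasDerivAt y (v t (y t)) t) :
    ∃ y : ℝ → E, y 0 = x ∧ IsIntegralCurve y v := by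
  choose y hy0 hy using h
  have agree (m n : ℕ) (hmn : m ≤ n) {t : ℝ} (ht : t ∈ Ioo (-m : ℝ) m) : y m t = y n t := by
    have hmn' : (m : ℝ) ≤ n := by exact_mod_cast hmn
    refine ODE_solution_unique_of_mem_Ioo (v := v) (K := K) (s := fun _ => univ) (t₀ := 0)
      (fun t _ => (hv t).lipschitzOnWith) ⟨by linarith [ht.1, ht.2], by linarith [ht.1, ht.2]⟩
      (fun t ht => ⟨hy m t ht, mem_univ _⟩)
      (fun t ht => ⟨hy n t ⟨by linarith [ht.1], by linarith [ht.2]⟩, mem_univ _⟩)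
      ((hy0 m).trans (hy0 n).symm) ht
  have mem_Ioo (s : ℝ) : s ∈ Ioo (-(⌊|s|⌋₊ + 1 : ℕ) : ℝ) (⌊|s|⌋₊ + 1 : ℕ) :=
    abs_lt.1 (by exact_mod_cast Nat.lt_floor_add_one |s|)
  refine ⟨fun t => y (⌊|t|⌋₊ + 1) t, hy0 _, fun t => ?_⟩
  have eventually_agree :
      (fun s => y (⌊|s|⌋₊ + 1) s) =ᶠ[𝓝 t] y (⌊|t|⌋₊ + 1) := by
    filter_upwards [Ioo_mem_nhds (mem_Ioo t).1 (mem_Ioo t).2] with s hs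
    refine agree _ _ (Nat.succ_le_of_lt ?_) (mem_Ioo s)
    exact (Nat.floor_lt (abs_nonneg s)).2 (abs_lt.2 hs)
  exact (hy _ t (mem_Ioo t)).congr_of_eventuallyEq eventually_agree

lemma exists_isIntegralCurve_of_lipschitz_of_bounded [CompleteSpace E] {v : ℝ → E → E} {K M : ℝ≥0}
    (hv : ∀ t, LipschitzWith K (v t)) (hcont : ∀ x, Continuous fun t => v t x)
    (hM : ∀ t x, ‖v t x‖ ≤ M) (x : E) : ∃ y : ℝ → E, y 0 = x ∧ IsIntegralCurve y v := by
  refine exists_isIntegralCurve_of_forall_Ioo hv fun n => ?_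
  have hn : (0 : ℝ) ≤ n := n.cast_nonneg
  have picardLindelof : IsPicardLindelof v (tmin := -(n : ℝ)) (tmax := n)
      ⟨0, neg_nonpos.2 hn, hn⟩ x (M * n) 0 M K :=
    { lipschitzOnWith := fun t _ => (hv t).lipschitzOnWith
      continuousOn := fun y _ => (hcont y).continuousOn
      norm_le := fun t _ y _ => hM t y
      mul_max_le := by simp }
  obtain ⟨y, hy0, hy⟩ := picardLindelof.exists_eq_forall_mem_Icc_hasDerivWithinAt₀
  exact ⟨y, hy0, fun t ht => (hy t (Ioo_subset_Icc_self ht)).hasDerivAt (Icc_mem_nhds ht.1 ht.2)⟩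

lemma continuous_integralCurve_parameter {P : Type*} [TopologicalSpace P] {v : P → ℝ → E → E}
    {K : ℝ≥0} (hv : ∀ p t, LipschitzWith K (v p t))
    (hcont : Continuous fun q : P × ℝ × E => v q.1 q.2.1 q.2.2) {y : P → ℝ → E}
    (hy : ∀ p, IsIntegralCurve (y p) (v p)) {x : E} (h0 : ∀ p, y p 0 = x) {t : ℝ} (ht : 0 ≤ t) :
    Continuous fun p => y p t := by
  refine continuous_iff_continuousAt.2 fun p₀ => Metric.tendsto_nhds.2 fun ε hε => ?_
  obtain ⟨η, hη, gronwall_lt⟩ : ∃ η > 0, gronwallBound 0 K η t < ε := by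
    have : ∀ᶠ η in 𝓝[>] (0 : ℝ), gronwallBound 0 K η t < ε :=
      ((gronwallBound_continuous_ε 0 K t).continuousAt.eventually_lt_const
        (by simpa [gronwallBound_ε0_δ0] using hε)).filter_mono nhdsWithin_le_nhds
    obtain ⟨η, hηε, hη⟩ := (this.and eventually_mem_nhdsWithin).exists
    exact ⟨η, hη, hηε⟩
  have field_close : ∀ᶠ p in 𝓝 p₀, ∀ s ∈ Icc 0 t, dist (v p₀ s (y p₀ s)) (v p s (y p₀ s)) < η := by
    refine isCompact_Icc.eventually_forall_of_forall_eventually fun s _ => ?_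
    have hys : Continuous fun q : P × ℝ => y p₀ q.2 := (hy p₀).continuous.comp continuous_snd
    have : Continuous fun q : P × ℝ => dist (v p₀ q.2 (y p₀ q.2)) (v q.1 q.2 (y p₀ q.2)) :=
      (hcont.comp (continuous_const.prodMk (continuous_snd.prodMk hys))).dist
        (hcont.comp (continuous_fst.prodMk (continuous_snd.prodMk hys)))
    exact this.continuousAt.eventually_lt_const (by simpa using hη)
  filter_upwards [field_close] with p hp
  have gronwall := dist_le_of_approx_trajectories_ODE (v := v p) (εf := η) (εg := 0) (δ := 0) (hv p)
    (hy p₀).continuous.continuousOn (fun s _ => (hy p₀ s).hasDerivWithinAt)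
    (fun s hs => (hp s (Ico_subset_Icc_self hs)).le) (hy p).continuous.continuousOn
    (fun s _ => (hy p s).hasDerivWithinAt) (fun s _ => (dist_self _).le)
    (by simp [h0]) t ⟨ht, le_rfl⟩
  rw [add_zero, sub_zero, dist_comm] at gronwall
  exact gronwall.trans_lt gronwall_lt

lemma lt_of_deriv_le_of_lipschitz {v : ℝ → ℝ → ℝ} {K : ℝ≥0} (hv : ∀ t, LipschitzWith K (v t))
    {y z y' : ℝ → ℝ} {a b c : ℝ} (hy : ∀ t, HasDerivAt y (y' t) t) (hz : IsIntegralCurve z v)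
    (hle : ∀ t, y' t ≤ v t (y t)) (ha : y a ≤ z a) (hc : c ∈ Ioo a b) (hlt : y' c < v c (y c)) :
    y b < z b := by
  have hlip (t : ℝ) : -(K * |z t - y t|) ≤ v t (z t) - v t (y t) := by
    have := (hv t).dist_le_mul (z t) (y t)
    rw [Real.dist_eq, Real.dist_eq] at this
    exact neg_le_of_abs_le this
  exact sub_pos.1 (pos_of_neg_mul_abs_le_deriv (u := fun t => z t - y t)
    (fun t _ => (hz t).sub (hy t)) (fun t _ => (hlip t).trans (by linarith [hle t]))
    (sub_nonneg.2 ha) hc ((hlip c).trans_lt (by linarith)))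

lemma integralCurve_comp_add_period {v : ℝ → E → E} {T : ℝ} (hT : ∀ t, v (t + T) = v t)
    {y : ℝ → E} (hy : IsIntegralCurve y v) : IsIntegralCurve (fun t => y (t + T)) v := fun t => by
  simpa [hT] using (hy (t + T)).comp_add_const t T

lemma periodic_integralCurve_of_eq {v : ℝ → E → E} {K : ℝ≥0} (hv : ∀ t, LipschitzWith K (v t))
    {T : ℝ} (hT : ∀ t, v (t + T) = v t) {y : ℝ → E} (hy : IsIntegralCurve y v) {t₀ : ℝ}
    (h : y (t₀ + T) = y t₀) : Function.Periodic y T :=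
  congrFun (integralCurve_eq_of_lipschitz hv (integralCurve_comp_add_period hT hy) hy h)

/- The displacement over one period has constant sign unless it vanishes, so its sum over `k`
periods can only vanish if it vanishes somewhere. -/
lemma periodic_integralCurve_of_eq_add_nsmul {v : ℝ → ℝ → ℝ} {K : ℝ≥0}
    (hv : ∀ t, LipschitzWith K (v t)) {T : ℝ} (hT : ∀ t, v (t + T) = v t) {y : ℝ → ℝ}
    (hy : IsIntegralCurve y v) {t₀ : ℝ} {k : ℕ} (hk : 0 < k) (h : y (t₀ + k * T) = y t₀) :
    Function.Periodic y T := by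
  have continuous_displacement : Continuous fun t => y (t + T) - y t :=
    (hy.continuous.comp (continuous_add_const T)).sub hy.continuous
  have sum_displacement :
      ∑ j ∈ Finset.range k, (y (t₀ + j * T + T) - y (t₀ + j * T)) = ∑ j ∈ Finset.range k, 0 := by
    have := Finset.sum_range_sub (fun j : ℕ => y (t₀ + j * T)) k
    simp only [Nat.cast_add, Nat.cast_one, add_one_mul, ← add_assoc, h] at this
    simpa using this
  have range_nonempty : (Finset.range k).Nonempty := ⟨0, by simpa using hk⟩
  obtain ⟨i, -, hi⟩ := Finset.exists_le_of_sum_le range_nonempty sum_displacement.le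
  obtain ⟨j, -, hj⟩ := Finset.exists_le_of_sum_le range_nonempty sum_displacement.ge
  obtain ⟨t, ht⟩ := mem_range_of_exists_le_of_exists_ge continuous_displacement ⟨_, hi⟩ ⟨_, hj⟩
  exact periodic_integralCurve_of_eq hv hT hy (sub_eq_zero.1 ht)

lemma integralCurve_eq_of_contDiff_of_bounded {f : E → E} (hf : ContDiff ℝ 1 f) [ProperSpace E]
    {y z : ℝ → E} (hy : IsIntegralCurve y fun _ => f) (hz : IsIntegralCurve z fun _ => f) {r : ℝ}
    (hyr : ∀ t, ‖y t‖ ≤ r) (hzr : ∀ t, ‖z t‖ ≤ r) {t₀ : ℝ} (h : y t₀ = z t₀) : y = z := by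
  obtain ⟨K, hK⟩ := hf.contDiffOn.exists_lipschitzOnWith one_ne_zero
    (convex_closedBall (0 : E) r) (isCompact_closedBall 0 r)
  exact ODE_solution_unique_univ (s := fun _ => Metric.closedBall 0 r) (fun _ => hK)
    (fun t => ⟨hy t, by simpa using hyr t⟩) (fun t => ⟨hz t, by simpa using hzr t⟩) h

lemma integralCurve_ne_of_not_constant {f : E → E} (hf : ContDiff ℝ 1 f) [ProperSpace E] {x : E}
    (hx : f x = 0) {y : ℝ → E} (hy : IsIntegralCurve y fun _ => f) {r : ℝ} (hyr : ∀ t, ‖y t‖ ≤ r)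
    (hconst : ¬∃ x, ∀ t, y t = x) (t : ℝ) : y t ≠ x := fun h => by
  have equilibrium : IsIntegralCurve (fun _ => x) fun _ => f := fun t => by
    simpa only [hx] using hasDerivAt_const t x
  exact hconst ⟨x, congrFun (integralCurve_eq_of_contDiff_of_bounded hf hy equilibrium
    (fun t => (hyr t).trans (le_max_left r ‖x‖)) (fun _ => le_max_right r ‖x‖) h)⟩

lemma exists_exp_lift {z z' : ℝ → ℂ} (hz : ∀ t, HasDerivAt z (z' t) t) (hz' : Continuous z')
    (h0 : ∀ t, z t ≠ 0) :
    ∃ L : ℝ → ℂ, (∀ t, z t = Complex.exp (L t)) ∧ ∀ t, HasDerivAt L (z' t / z t) t := by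
  have continuous_z : Continuous z := continuous_iff_continuousAt.2 fun t => (hz t).continuousAt
  have continuous_quotient : Continuous fun t => z' t / z t := hz'.div continuous_z h0
  let L : ℝ → ℂ := fun t => Complex.log (z 0) + ∫ s in (0 : ℝ)..t, z' s / z s
  have hL (t : ℝ) : HasDerivAt L (z' t / z t) t :=
    (continuous_quotient.integral_hasStrictDerivAt 0 t).hasDerivAt.const_add _
  refine ⟨L, fun t => ?_, hL⟩
  have hquot (s : ℝ) : HasDerivAt (fun s => z s * Complex.exp (-L s)) 0 s := by
    refine ((hz s).mul (hL s).neg.cexp).congr_deriv ?_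
    field_simp [h0 s]
    ring
  have hconst := is_const_of_deriv_eq_zero (fun s => (hquot s).differentiableAt)
    (fun s => (hquot s).deriv) t 0
  have hL0 : Complex.exp (L 0) = z 0 := by simp [L, Complex.exp_log (h0 0)]
  simp only [Complex.exp_neg, hL0, mul_inv_cancel₀ (h0 0)] at hconst
  exact eq_of_mul_inv_eq_one hconst

end IntegralCurves

section Eigenvalues

lemma complexEigenvalues_eq_of_trace_eq_zero {A : Matrix (Fin 2) (Fin 2) ℝ} {ω : ℝ}
    (htrace : A.trace = 0) (hdet : A.det = ω ^ 2) :
    complexEigenvalues A = {Complex.I * ω, -(Complex.I * ω)} := by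
  have factorization : (A.map (algebraMap ℝ ℂ)).charpoly =
      (({Complex.I * ω, -(Complex.I * ω)} : Multiset ℂ).map
        fun z => Polynomial.X - Polynomial.C z).prod := by
    have hω : ((ω ^ 2 : ℝ) : ℂ) = -(Complex.I * ω * (Complex.I * ω)) := by
      push_cast
      linear_combination (ω : ℂ) ^ 2 * Complex.I_mul_I
    rw [Matrix.charpoly_map, Matrix.charpoly_fin_two, htrace, hdet]
    simp only [Polynomial.C_0, zero_mul, sub_zero, Polynomial.map_add,
      Polynomial.map_pow, Polynomial.map_X, Polynomial.map_C, Complex.coe_algebraMap, hω,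
      Multiset.insert_eq_cons, Multiset.map_cons, Multiset.map_singleton, Multiset.prod_cons,
      Multiset.prod_singleton, Polynomial.C_neg, Polynomial.C_mul]
    ring
  rw [complexEigenvalues, factorization, Polynomial.roots_multiset_prod_X_sub_C]

lemma mem_complexEigenvalues_of_sq_add_sq_eq_det {A : Matrix (Fin 2) (Fin 2) ℝ} {α β : ℝ}
    (htrace : A.trace = 2 * α) (hdet : A.det = α ^ 2 + β ^ 2) :
    (α : ℂ) + Complex.I * β ∈ complexEigenvalues A := by
  rw [complexEigenvalues, Polynomial.mem_roots (Matrix.charpoly_monic _).ne_zero,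
    Matrix.charpoly_map, Matrix.charpoly_fin_two, htrace, hdet, Polynomial.IsRoot.def]
  simp only [Polynomial.map_add, Polynomial.map_sub, Polynomial.map_mul, Polynomial.map_pow,
    Polynomial.map_X, Polynomial.map_C, Polynomial.eval_add, Polynomial.eval_sub,
    Polynomial.eval_mul, Polynomial.eval_pow, Polynomial.eval_X, Polynomial.eval_C,
    Complex.coe_algebraMap]
  push_cast
  linear_combination (β : ℂ) ^ 2 * Complex.I_mul_I

lemma jacobian_neg (f : (Fin 2 → ℝ) → Fin 2 → ℝ) (x : Fin 2 → ℝ) :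
    jacobian (fun u => -f u) x = -jacobian f x := by
  simp [jacobian, fderiv_fun_neg]

lemma jacobian_mulVec (f : (Fin 2 → ℝ) → Fin 2 → ℝ) (x u : Fin 2 → ℝ) :
    (jacobian f x).mulVec u = fderiv ℝ f x u := by
  rw [jacobian, ← Matrix.toLin'_apply, Matrix.toLin'_toMatrix']
  rfl

end Eigenvalues

section Stability

lemma le_mul_exp_of_deriv_lt {φ φ' : ℝ → ℝ} {κ β τ : ℝ} (hκ : 0 ≤ κ) (hβ : 0 < β)
    (hφ : ContinuousOn φ (Icc 0 τ))
    (hφ' : ∀ t ∈ Ico 0 τ, HasDerivWithinAt φ (φ' t) (Ici t) t) (h0 : φ 0 ≤ β)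
    (hlt : ∀ t ∈ Ico 0 τ, 0 < φ t → φ t ≤ β → φ' t < -(κ * φ t)) :
    ∀ t ∈ Icc 0 τ, φ t ≤ β * Real.exp (-(κ * t)) := by
  have hB (t : ℝ) : HasDerivAt (fun t => β * Real.exp (-(κ * t)))
      (-(κ * (β * Real.exp (-(κ * t))))) t :=
    ((((hasDerivAt_id' t).const_mul κ).fun_neg.exp).const_mul β).congr_deriv (by ring)
  refine fun t ht => image_le_of_deriv_right_lt_deriv_boundary hφ hφ' (by simpa using h0) hB
    (fun s hs hφs => ?_) ht
  rw [← hφs]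
  have hexp : Real.exp (-(κ * s)) ≤ 1 := Real.exp_le_one_iff.2 (neg_nonpos.2 (mul_nonneg hκ hs.1))
  exact hlt s hs (hφs ▸ by positivity) (hφs ▸ mul_le_of_le_one_right hβ.le hexp)

variable {E : Type*} [NormedAddCommGroup E] [NormedSpace ℝ E] {f : E → E} {f' : E →L[ℝ] E} {x₀ : E}
  {B : E →L[ℝ] E →L[ℝ] ℝ} {c m : ℝ}

lemma exists_eventually_bilinear_le_of_hasFDerivAt (hf : HasFDerivAt f f' x₀) (h0 : f x₀ = 0)
    (hc : 0 < c) (hB : ∀ u, B u (f' u) ≤ -(c * ‖u‖ ^ 2)) :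
    ∃ κ > 0, ∀ᶠ x in 𝓝 x₀, B (x - x₀) (f x) ≤ -(κ * B (x - x₀) (x - x₀)) := by
  have hκ : 0 < c / (2 * (‖B‖ + 1)) := by positivity
  refine ⟨c / (2 * (‖B‖ + 1)), hκ, ?_⟩
  filter_upwards [hf.isLittleO.def hκ] with x hx
  rw [h0, sub_zero] at hx
  have split : B (x - x₀) (f x) = B (x - x₀) (f' (x - x₀)) + B (x - x₀) (f x - f' (x - x₀)) := by
    rw [← map_add, add_sub_cancel]
  have remainder_le : B (x - x₀) (f x - f' (x - x₀)) ≤ c / 2 * ‖x - x₀‖ ^ 2 :=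
    calc B (x - x₀) (f x - f' (x - x₀))
      _ ≤ ‖B‖ * ‖x - x₀‖ * ‖f x - f' (x - x₀)‖ := (le_abs_self _).trans (B.le_opNorm₂ _ _)
      _ ≤ (‖B‖ + 1) * ‖x - x₀‖ * (c / (2 * (‖B‖ + 1)) * ‖x - x₀‖) := by gcongr; linarith
      _ = c / 2 * ‖x - x₀‖ ^ 2 := by field_simp
  have form_le : c / (2 * (‖B‖ + 1)) * B (x - x₀) (x - x₀) ≤ c / 2 * ‖x - x₀‖ ^ 2 :=
    calc c / (2 * (‖B‖ + 1)) * B (x - x₀) (x - x₀)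
      _ ≤ c / (2 * (‖B‖ + 1)) * ((‖B‖ + 1) * ‖x - x₀‖ * ‖x - x₀‖) := by
        gcongr
        exact ((le_abs_self _).trans (B.le_opNorm₂ _ _)).trans (by gcongr; linarith)
      _ = c / 2 * ‖x - x₀‖ ^ 2 := by field_simp
  linarith [hB (x - x₀)]

lemma exists_exp_decay_of_lyapunov (hf : HasFDerivAt f f' x₀) (h0 : f x₀ = 0)
    (hsymm : ∀ u w, B u w = B w u) (hm : ∀ u, m * ‖u‖ ^ 2 ≤ B u u) (hm0 : 0 < m) (hc : 0 < c)
    (hB : ∀ u, B u (f' u) ≤ -(c * ‖u‖ ^ 2)) :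
    ∃ β₀ > 0, ∃ κ > 0, ∀ β ∈ Ioo 0 β₀, ∀ (τ : ℝ) (y : ℝ → E),
      IsIntegralCurveOn y (fun _ => f) (Icc 0 τ) → B (y 0 - x₀) (y 0 - x₀) ≤ β →
        ∀ t ∈ Icc 0 τ, m * ‖y t - x₀‖ ^ 2 ≤ β * Real.exp (-(κ * t)) := by
  obtain ⟨κ, hκ, hdecr⟩ := exists_eventually_bilinear_le_of_hasFDerivAt hf h0 hc hB
  obtain ⟨ρ, hρ, hdecr⟩ := Metric.eventually_nhds_iff.1 hdecr
  refine ⟨m * ρ ^ 2, by positivity, κ, hκ, fun β hβ τ y hy hy0 t ht => (hm _).trans ?_⟩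
  have hderiv (s : ℝ) (hs : s ∈ Icc 0 τ) : HasDerivWithinAt (fun s => B (y s - x₀) (y s - x₀))
      (2 * B (y s - x₀) (f (y s))) (Icc 0 τ) s := by
    have hsub := (hy s hs).sub_const x₀
    refine (B.hasFDerivWithinAt_of_bilinear hsub.hasFDerivWithinAt
      hsub.hasFDerivWithinAt).hasDerivWithinAt.congr_deriv ?_
    simp [hsymm (f (y s)), two_mul]
  refine le_mul_exp_of_deriv_lt hκ.le hβ.1 (fun s hs => (hderiv s hs).continuousWithinAt)
    (fun s hs => ((hderiv s (Ico_subset_Icc_self hs)).mono_of_mem_nhdsWithin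
      (Icc_mem_nhdsGE_of_mem hs))) hy0 (fun s _ hpos hle => ?_) t ht
  have close : dist (y s) x₀ < ρ := by
    rw [dist_eq_norm]
    refine lt_of_pow_lt_pow_left₀ 2 hρ.le (lt_of_mul_lt_mul_left ?_ hm0.le)
    exact (hm _).trans_lt (hle.trans_lt hβ.2)
  linarith [hdecr close, mul_pos hκ hpos]

lemma isAsymptoticallyStable_of_lyapunov {f : (Fin 2 → ℝ) → Fin 2 → ℝ} {x₀ : Fin 2 → ℝ}
    {f' : (Fin 2 → ℝ) →L[ℝ] Fin 2 → ℝ} {B : (Fin 2 → ℝ) →L[ℝ] (Fin 2 → ℝ) →L[ℝ] ℝ}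
    (hf : HasFDerivAt f f' x₀) (h0 : f x₀ = 0)
    (hsymm : ∀ u w, B u w = B w u) (hm : ∀ u, m * ‖u‖ ^ 2 ≤ B u u) (hm0 : 0 < m) (hc : 0 < c)
    (hB : ∀ u, B u (f' u) ≤ -(c * ‖u‖ ^ 2)) : IsAsymptoticallyStable f x₀ := by
  obtain ⟨β₀, hβ₀, κ, hκ, decay⟩ := exists_exp_decay_of_lyapunov hf h0 hsymm hm hm0 hc hB
  have close (β : ℝ) (hβ : 0 < β) : ∃ δ > 0, ∀ x, dist x x₀ < δ → B (x - x₀) (x - x₀) < β := by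
    have hcont : Continuous fun x => B (x - x₀) (x - x₀) := by fun_prop
    exact Metric.eventually_nhds_iff.1
      (hcont.continuousAt.eventually_lt_const (by simpa using hβ))
  refine ⟨fun ε hε => ?_, ?_⟩
  · have hβ : 0 < min β₀ (m * ε ^ 2) := by positivity
    obtain ⟨δ, hδ, hclose⟩ := close _ (half_pos hβ)
    refine ⟨δ, hδ, fun τ y hy hy0 t ht => ?_⟩
    have hdecay := decay (min β₀ (m * ε ^ 2) / 2)
      ⟨half_pos hβ, (half_lt_self hβ).trans_le (min_le_left _ _)⟩ τ y hy (hclose _ hy0).le t ht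
    have hexp : Real.exp (-(κ * t)) ≤ 1 :=
      Real.exp_le_one_iff.2 (neg_nonpos.2 (mul_nonneg hκ.le ht.1))
    rw [dist_eq_norm]
    refine lt_of_pow_lt_pow_left₀ 2 hε.le (lt_of_mul_lt_mul_left ?_ hm0.le)
    calc m * ‖y t - x₀‖ ^ 2
      _ ≤ min β₀ (m * ε ^ 2) / 2 := hdecay.trans (mul_le_of_le_one_right (half_pos hβ).le hexp)
      _ < m * ε ^ 2 := (half_lt_self hβ).trans_le (min_le_right _ _)
  · obtain ⟨δ, hδ, hclose⟩ := close _ (half_pos hβ₀)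
    refine ⟨δ, hδ, fun y hy hy0 => ?_⟩
    have bound (t : ℝ) (ht : 0 ≤ t) :
        ‖y t - x₀‖ ^ 2 ≤ β₀ / 2 * Real.exp (-(κ * t)) / m := by
      rw [le_div_iff₀' hm0]
      exact decay _ ⟨half_pos hβ₀, half_lt_self hβ₀⟩ t y (hy.mono Icc_subset_Ici_self)
        (hclose _ hy0).le t ⟨ht, le_rfl⟩
    have tendsto_bound : Tendsto (fun t => β₀ / 2 * Real.exp (-(κ * t)) / m) atTop (𝓝 0) := by
      have := Real.tendsto_exp_neg_atTop_nhds_zero.comp (tendsto_id.const_mul_atTop hκ)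
      simpa using (this.const_mul (β₀ / 2)).div_const m
    rw [tendsto_iff_norm_sub_tendsto_zero]
    have tendsto_sq := squeeze_zero' (Eventually.of_forall fun t => sq_nonneg ‖y t - x₀‖)
      ((eventually_ge_atTop 0).mono bound) tendsto_bound
    simpa [Real.sqrt_sq (norm_nonneg _)] using tendsto_sq.sqrt

/-- The quadratic form `det A |u|² + |adj A u|²`, in polarized form. It is a Lyapunov function for
`u' = A u` in the plane: since `A + adj A = tr A`, its derivative there is `2 det A tr A |u|²`. -/
noncomputable def lyapunovForm (A : Matrix (Fin 2) (Fin 2) ℝ) :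
    (Fin 2 → ℝ) →L[ℝ] (Fin 2 → ℝ) →L[ℝ] ℝ :=
  (Matrix.toLinearMap₂' ℝ (A.det • 1 + A.adjugate.transpose * A.adjugate)).toContinuousBilinearMap

lemma lyapunovForm_apply (A : Matrix (Fin 2) (Fin 2) ℝ) (u w : Fin 2 → ℝ) :
    lyapunovForm A u w =
      A.det * (u ⬝ᵥ w) + A.adjugate.mulVec u ⬝ᵥ A.adjugate.mulVec w := by
  rw [lyapunovForm, LinearMap.toContinuousBilinearMap_apply, Matrix.toLinearMap₂'_apply',
    Matrix.add_mulVec, Matrix.smul_mulVec, Matrix.one_mulVec, dotProduct_add, dotProduct_smul,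
    smul_eq_mul, ← Matrix.mulVec_mulVec, Matrix.dotProduct_mulVec, Matrix.vecMul_transpose]

lemma lyapunovForm_mulVec (A : Matrix (Fin 2) (Fin 2) ℝ) (u : Fin 2 → ℝ) :
    lyapunovForm A u (A.mulVec u) = A.det * A.trace * (u ⬝ᵥ u) := by
  simp only [lyapunovForm_apply, Matrix.adjugate_fin_two, Matrix.det_fin_two,
    Matrix.trace_fin_two, Matrix.mulVec, dotProduct, Fin.sum_univ_two, Matrix.of_apply,
    Matrix.cons_val_zero, Matrix.cons_val_one]
  ring

lemma norm_sq_le_dotProduct_self {n : Type*} [Fintype n] (u : n → ℝ) : ‖u‖ ^ 2 ≤ u ⬝ᵥ u := by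
  have hnorm : ‖u‖ ≤ √(u ⬝ᵥ u) :=
    (pi_norm_le_iff_of_nonneg (Real.sqrt_nonneg _)).2 fun i =>
      Real.abs_le_sqrt ((sq (u i)).trans_le
        (Finset.single_le_sum (fun j _ => mul_self_nonneg (u j)) (Finset.mem_univ i)))
  exact (Real.le_sqrt (norm_nonneg u)
    (Finset.sum_nonneg fun i _ => mul_self_nonneg (u i))).1 hnorm

lemma isAsymptoticallyStable_of_trace_neg_of_det_pos {f : (Fin 2 → ℝ) → Fin 2 → ℝ}
    {x₀ : Fin 2 → ℝ} (hf : DifferentiableAt ℝ f x₀) (h0 : f x₀ = 0)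
    (htrace : (jacobian f x₀).trace < 0) (hdet : 0 < (jacobian f x₀).det) :
    IsAsymptoticallyStable f x₀ := by
  set A := jacobian f x₀ with hA
  refine isAsymptoticallyStable_of_lyapunov (B := lyapunovForm A) (m := A.det)
    (c := -(A.det * A.trace)) hf.hasFDerivAt h0 (fun u w => ?_) (fun u => ?_) hdet
    (neg_pos.2 (mul_neg_of_pos_of_neg hdet htrace)) fun u => ?_
  · simp only [lyapunovForm_apply, dotProduct_comm]
  · rw [lyapunovForm_apply]
    have := mul_le_mul_of_nonneg_left (norm_sq_le_dotProduct_self u) hdet.le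
    linarith [(sq_nonneg _).trans (norm_sq_le_dotProduct_self (A.adjugate.mulVec u))]
  · rw [← jacobian_mulVec, ← hA, lyapunovForm_mulVec]
    nlinarith [mul_neg_of_pos_of_neg hdet htrace, norm_sq_le_dotProduct_self u]

lemma isRepelling_of_trace_pos_of_det_pos {f : (Fin 2 → ℝ) → Fin 2 → ℝ} {x₀ : Fin 2 → ℝ}
    (hf : DifferentiableAt ℝ f x₀) (h0 : f x₀ = 0) (htrace : 0 < (jacobian f x₀).trace)
    (hdet : 0 < (jacobian f x₀).det) : IsRepelling f x₀ := by
  refine isAsymptoticallyStable_of_trace_neg_of_det_pos hf.neg (by simp [h0]) ?_ ?_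
  · rwa [jacobian_neg, Matrix.trace_neg, neg_lt_zero]
  · rwa [jacobian_neg, Matrix.det_neg, Fintype.card_fin, neg_one_sq, one_mul]

end Stability

section LienardField

/-- The planar form `ψ' = v`, `v' = 2 (γ + g ψ) v - k ψ` of an oscillator whose linear gain `γ` is
modified by the position-dependent gain `g`; `u 0 = ψ` and `u 1 = v`. -/
def lienardField (g : ℝ → ℝ) (k γ : ℝ) (u : Fin 2 → ℝ) : Fin 2 → ℝ :=
  ![u 1, 2 * (γ + g (u 0)) * u 1 - k * u 0]

lemma phaseField_eq_lienardField (a b E : ℝ) :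
    phaseField a b E = lienardField (fun x => a * x ^ 2 - b * (x ^ 2) ^ 2) (2 * E) := by
  funext γ u
  simp only [phaseField, lienardField, nonreciprocity, add_sub_assoc]

variable {g : ℝ → ℝ}

lemma contDiff_lienardField {n : WithTop ℕ∞} (hg : ContDiff ℝ n g) (k : ℝ) :
    ContDiff ℝ n fun q : ℝ × (Fin 2 → ℝ) => lienardField g k q.1 q.2 := by
  refine contDiff_pi.2 fun i => ?_
  fin_cases i
  · simp only [lienardField, Fin.zero_eta, Matrix.cons_val_zero]
    fun_prop
  · simp only [lienardField, Fin.mk_one, Matrix.cons_val_one, Matrix.cons_val_fin_one]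
    fun_prop

lemma lienardField_zero (g : ℝ → ℝ) (k γ : ℝ) : lienardField g k γ 0 = 0 := by
  ext i
  fin_cases i <;> simp [lienardField]

lemma hasFDerivAt_lienardField_zero (hg : DifferentiableAt ℝ g 0) (hg0 : g 0 = 0) (k γ : ℝ) :
    HasFDerivAt (lienardField g k γ)
      (LinearMap.toContinuousLinearMap
        (Matrix.toLin' (!![0, 1; -k, 2 * γ] : Matrix (Fin 2) (Fin 2) ℝ))) 0 := by
  have hproj (i : Fin 2) : HasFDerivAt (fun u : Fin 2 → ℝ => u i)
      (ContinuousLinearMap.proj (R := ℝ) (φ := fun _ : Fin 2 => ℝ) i) 0 := hasFDerivAt_apply i 0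
  refine hasFDerivAt_pi'.2 fun i => ?_
  fin_cases i
  · refine (hproj 1).congr_fderiv ?_
    ext u
    simp [Matrix.toLin'_apply, Matrix.vecHead, Matrix.vecTail]
  · have hgain := (hg.hasDerivAt.comp_hasFDerivAt (0 : Fin 2 → ℝ) (hproj 0)).const_add γ
    refine (((hgain.const_mul 2).mul (hproj 1)).sub ((hproj 0).const_mul k)).congr_fderiv ?_
    ext u
    simp [hg0, Matrix.toLin'_apply, Matrix.vecHead, Matrix.vecTail, sub_eq_neg_add]

variable (hg : DifferentiableAt ℝ g 0) (hg0 : g 0 = 0)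
include hg hg0

lemma jacobian_lienardField_zero (k γ : ℝ) :
    jacobian (lienardField g k γ) 0 = !![0, 1; -k, 2 * γ] := by
  rw [jacobian, (hasFDerivAt_lienardField_zero hg hg0 k γ).fderiv]
  exact LinearMap.toMatrix'_toLin' _

lemma trace_jacobian_lienardField_zero (k γ : ℝ) :
    (jacobian (lienardField g k γ) 0).trace = 2 * γ := by
  simp [jacobian_lienardField_zero hg hg0, Matrix.trace_fin_two]

lemma det_jacobian_lienardField_zero (k γ : ℝ) : (jacobian (lienardField g k γ) 0).det = k := by
  simp [jacobian_lienardField_zero hg hg0, Matrix.det_fin_two]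

lemma isAsymptoticallyStable_lienardField_zero {k γ : ℝ} (hk : 0 < k) (hγ : γ < 0) :
    IsAsymptoticallyStable (lienardField g k γ) 0 := by
  refine isAsymptoticallyStable_of_trace_neg_of_det_pos
    (hasFDerivAt_lienardField_zero hg hg0 k γ).differentiableAt (lienardField_zero g k γ) ?_ ?_
  · rw [trace_jacobian_lienardField_zero hg hg0]
    linarith
  · rwa [det_jacobian_lienardField_zero hg hg0]

lemma isRepelling_lienardField_zero {k γ : ℝ} (hk : 0 < k) (hγ : 0 < γ) :
    IsRepelling (lienardField g k γ) 0 := by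
  refine isRepelling_of_trace_pos_of_det_pos
    (hasFDerivAt_lienardField_zero hg hg0 k γ).differentiableAt (lienardField_zero g k γ) ?_ ?_
  · rw [trace_jacobian_lienardField_zero hg hg0]
    linarith
  · rwa [det_jacobian_lienardField_zero hg hg0]

lemma exists_eigenvalue_crossing_lienardField {w : ℝ} (hw : 0 < w) :
    ∃ (l : ℝ → ℂ) (c : ℝ), ContDiffAt ℝ 1 l 0 ∧ l 0 = Complex.I * w ∧
      (∀ᶠ p in 𝓝 (0 : ℝ), l p ∈ complexEigenvalues (jacobian (lienardField g (w ^ 2) p) 0)) ∧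
      HasDerivAt (fun p => (l p).re) c 0 ∧ c ≠ 0 := by
  refine ⟨fun p => p + Complex.I * √(w ^ 2 - p ^ 2), 1, ?_, ?_, ?_, ?_, one_ne_zero⟩
  · have hsqrt : ContDiffAt ℝ 1 (fun p : ℝ => √(w ^ 2 - p ^ 2)) 0 :=
      ContDiffAt.sqrt (by fun_prop) (by simpa using hw.ne')
    exact Complex.ofRealCLM.contDiff.contDiffAt.add
      (contDiffAt_const.mul (Complex.ofRealCLM.contDiff.contDiffAt.comp 0 hsqrt))
  · simp [Real.sqrt_sq hw.le]
  · have hsmall : ∀ᶠ p : ℝ in 𝓝 0, p ^ 2 < w ^ 2 :=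
      (continuous_pow 2).continuousAt.eventually_lt_const (by simpa using pow_pos hw 2)
    filter_upwards [hsmall] with p hp
    refine mem_complexEigenvalues_of_sq_add_sq_eq_det
      (trace_jacobian_lienardField_zero hg hg0 _ _) ?_
    rw [det_jacobian_lienardField_zero hg hg0, Real.sq_sqrt (sub_nonneg.2 hp.le)]
    ring
  · simpa using hasDerivAt_id' (0 : ℝ)

end LienardField

section PolarCoordinates

/-- The identification of the complex coordinate `z = ψ - i v / w` with the point `(ψ, v)`. In this
coordinate the linear oscillator `ψ'' = - w² ψ` is the rotation `z' = i w z`. -/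
def planeOfComplex (w : ℝ) (z : ℂ) : Fin 2 → ℝ := ![z.re, -(w * z.im)]

/-- The field `lienardField g (w ^ 2) γ` in the coordinate of `planeOfComplex`. -/
noncomputable def complexLienardField (g : ℝ → ℝ) (w γ : ℝ) (z : ℂ) : ℂ :=
  Complex.I * (w * z + (2 * (γ + g z.re) * z.im : ℝ))

/-- The angular speed of `complexLienardField` at the angle `θ` where the total gain is `D`. -/
noncomputable def angularSpeed (w D θ : ℝ) : ℝ := w + 2 * D * Real.sin θ * Real.cos θ

/-- The derivative of the logarithm of the radius with respect to the angle along
`complexLienardField`, at the angle `θ` where the total gain is `D`. -/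
noncomputable def polarSlope (w D θ : ℝ) : ℝ := 2 * D * Real.sin θ ^ 2 / angularSpeed w D θ

/-- `R` and `θ` are the logarithm of the radius and the angle of a solution of
`z' = complexLienardField g w γ z`. -/
def IsPolarSolution (g : ℝ → ℝ) (w γ : ℝ) (R θ : ℝ → ℝ) : Prop := ∀ t,
  HasDerivAt R (2 * (γ + g (Real.exp (R t) * Real.cos (θ t))) * Real.sin (θ t) ^ 2) t ∧
    HasDerivAt θ (angularSpeed w (γ + g (Real.exp (R t) * Real.cos (θ t))) (θ t)) t

variable {g : ℝ → ℝ} {w γ : ℝ}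

lemma planeOfComplex_injective (hw : w ≠ 0) : Function.Injective (planeOfComplex w) := by
  intro z z' h
  refine Complex.ext (congrFun h 0) (mul_left_cancel₀ hw (neg_inj.1 (congrFun h 1)))

lemma planeOfComplex_zero (w : ℝ) : planeOfComplex w 0 = 0 := by
  ext i
  fin_cases i <;> simp [planeOfComplex]

lemma exists_planeOfComplex_eq (hw : w ≠ 0) (u : Fin 2 → ℝ) : ∃ z, planeOfComplex w z = u :=
  ⟨⟨u 0, -u 1 / w⟩, by ext i; fin_cases i <;> simp [planeOfComplex, mul_div_cancel₀ _ hw]⟩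

lemma norm_planeOfComplex_le (hw : 0 ≤ w) (z : ℂ) : ‖planeOfComplex w z‖ ≤ max 1 w * ‖z‖ := by
  refine (pi_norm_le_iff_of_nonneg (by positivity)).2 fun i => ?_
  fin_cases i
  · calc ‖z.re‖ ≤ 1 * ‖z‖ := by simpa using Complex.abs_re_le_norm z
      _ ≤ max 1 w * ‖z‖ := by gcongr; exact le_max_left 1 w
  · calc ‖-(w * z.im)‖ = w * |z.im| := by rw [norm_neg, norm_mul, Real.norm_of_nonneg hw]; rfl
      _ ≤ max 1 w * ‖z‖ := by gcongr; exacts [le_max_right 1 w, Complex.abs_im_le_norm z]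

lemma complexLienardField_re (z : ℂ) : (complexLienardField g w γ z).re = -(w * z.im) := by
  simp [complexLienardField]

lemma complexLienardField_im (z : ℂ) :
    (complexLienardField g w γ z).im = w * z.re + 2 * (γ + g z.re) * z.im := by
  simp [complexLienardField]

lemma lienardField_planeOfComplex (z : ℂ) : lienardField g (w ^ 2) γ (planeOfComplex w z) =
    planeOfComplex w (complexLienardField g w γ z) := by
  ext i
  fin_cases i
  · exact (complexLienardField_re z).symm
  · change 2 * (γ + g z.re) * -(w * z.im) - w ^ 2 * z.re = -(w * (complexLienardField g w γ z).im)
    rw [complexLienardField_im]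
    ring

lemma hasDerivAt_complex_iff {z : ℝ → ℂ} {z' : ℂ} {t : ℝ} : HasDerivAt z z' t ↔
    HasDerivAt (fun t => (z t).re) z'.re t ∧ HasDerivAt (fun t => (z t).im) z'.im t := by
  refine ⟨fun h => ⟨Complex.reCLM.hasFDerivAt.comp_hasDerivAt t h,
    Complex.imCLM.hasFDerivAt.comp_hasDerivAt t h⟩, fun h => ?_⟩
  simpa only [Complex.re_add_im] using
    (h.1.ofReal_comp.add (h.2.ofReal_comp.mul_const Complex.I)).congr_of_eventuallyEq
      (Eventually.of_forall fun s => (Complex.re_add_im (z s)).symm)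

lemma isIntegralCurve_planeOfComplex_iff (hw : w ≠ 0) {z : ℝ → ℂ} :
    IsIntegralCurve (fun t => planeOfComplex w (z t)) (fun _ => lienardField g (w ^ 2) γ) ↔
      IsIntegralCurve z fun _ => complexLienardField g w γ := by
  simp only [IsIntegralCurve, lienardField_planeOfComplex, hasDerivAt_pi, Fin.forall_fin_two,
    hasDerivAt_complex_iff]
  refine forall_congr' fun t => ?_
  refine and_congr Iff.rfl ⟨fun h => ?_, fun h => (h.const_mul w).fun_neg⟩
  simpa [planeOfComplex, mul_div_cancel_left₀ _ hw] using h.fun_neg.div_const w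

lemma complexLienardField_exp (L : ℂ) :
    complexLienardField g w γ (Complex.exp L) = Complex.exp L *
      ⟨2 * (γ + g (Real.exp L.re * Real.cos L.im)) * Real.sin L.im ^ 2,
        angularSpeed w (γ + g (Real.exp L.re * Real.cos L.im)) L.im⟩ := by
  apply Complex.ext
  · rw [complexLienardField_re, Complex.mul_re, Complex.exp_re, Complex.exp_im, angularSpeed]
    ring
  · rw [complexLienardField_im, Complex.mul_im, Complex.exp_re, Complex.exp_im, angularSpeed]
    linear_combination -2 * (γ + g (Real.exp L.re * Real.cos L.im)) * Real.exp L.re *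
      Real.sin L.im * Real.sin_sq_add_cos_sq L.im

lemma IsPolarSolution.isIntegralCurve_exp {R θ : ℝ → ℝ} (h : IsPolarSolution g w γ R θ) :
    IsIntegralCurve (fun t => Complex.exp ⟨R t, θ t⟩) fun _ => complexLienardField g w γ :=
  fun t => (hasDerivAt_complex_iff.2 (h t)).cexp.congr_deriv (complexLienardField_exp _).symm

lemma exists_isPolarSolution (hg : Continuous g) {z : ℝ → ℂ}
    (hz : IsIntegralCurve z fun _ => complexLienardField g w γ) (h0 : ∀ t, z t ≠ 0) :
    ∃ R θ : ℝ → ℝ, IsPolarSolution g w γ R θ ∧ ∀ t, z t = Complex.exp ⟨R t, θ t⟩ := by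
  have continuous_field : Continuous (complexLienardField g w γ) := by
    unfold complexLienardField
    fun_prop
  obtain ⟨L, hzL, hL⟩ := exists_exp_lift hz (continuous_field.comp hz.continuous) h0
  refine ⟨fun t => (L t).re, fun t => (L t).im, fun t => ?_, hzL⟩
  have hLt : HasDerivAt L (complexLienardField g w γ (z t) / z t) t := hL t
  rw [hzL, complexLienardField_exp, mul_div_cancel_left₀ _ (Complex.exp_ne_zero _)] at hLt
  exact hasDerivAt_complex_iff.1 hLt

/-- The equation for the logarithm `r` of the radius as a function of the angle `s` along
`complexLienardField`. -/
noncomputable def radialField (g : ℝ → ℝ) (w γ s r : ℝ) : ℝ :=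
  polarSlope w (γ + g (Real.exp r * Real.cos s)) s

lemma IsPolarSolution.exists_isIntegralCurve_radialField {R θ : ℝ → ℝ} {c : ℝ}
    (h : IsPolarSolution g w γ R θ) (hc : 0 < c)
    (hspeed : ∀ t, c ≤ angularSpeed w (γ + g (Real.exp (R t) * Real.cos (θ t))) (θ t)) :
    ∃ time : ℝ → ℝ, (∀ t, time (θ t) = t) ∧ (∀ s, θ (time s) = s) ∧
      IsIntegralCurve (fun s => R (time s)) (radialField g w γ) := by
  obtain ⟨time, htime, hθ, hderiv⟩ := exists_inverse_hasDerivAt hc (fun t => (h t).2) hspeed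
  refine ⟨time, htime, hθ, fun s => ((h _).1.comp s (hderiv s)).congr_deriv ?_⟩
  simp only [radialField, polarSlope, hθ, div_eq_mul_inv]

lemma exists_isPolarSolution_of_isIntegralCurve_radialField (hg : Continuous g) {ρ : ℝ → ℝ}
    {c C : ℝ} (hρ : IsIntegralCurve ρ (radialField g w γ)) (hc : 0 < c) {Q : ℝ → ℝ}
    (hQ : ∀ s, Q s = angularSpeed w (γ + g (Real.exp (ρ s) * Real.cos s)) s)
    (hcQ : ∀ s, c ≤ Q s) (hQC : ∀ s, Q s ≤ C) :
    ∃ θ : ℝ → ℝ, IsPolarSolution g w γ (fun t => ρ (θ t)) θ ∧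
      (∀ s, θ (∫ u in 0..s, (Q u)⁻¹) = s) ∧ ∀ t, ∫ u in 0..θ t, (Q u)⁻¹ = t := by
  have hQ0 (s : ℝ) : 0 < Q s := hc.trans_le (hcQ s)
  have continuous_inv : Continuous fun u => (Q u)⁻¹ := by
    have continuous_ρ := hρ.continuous
    refine Continuous.inv₀ ?_ fun s => (hQ0 s).ne'
    rw [funext hQ]
    unfold angularSpeed
    fun_prop
  obtain ⟨θ, hθ, htime, hderiv⟩ := exists_inverse_hasDerivAt
    (f := fun s => ∫ u in 0..s, (Q u)⁻¹) (inv_pos.2 (hc.trans_le ((hcQ 0).trans (hQC 0))))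
    (fun s => (continuous_inv.integral_hasStrictDerivAt 0 s).hasDerivAt)
    (fun s => inv_anti₀ (hQ0 s) (hQC s))
  refine ⟨θ, fun t => ?_, hθ, htime⟩
  have hθ' := (hderiv t).congr_deriv ((inv_inv _).trans (hQ (θ t)))
  refine ⟨((hρ (θ t)).comp t hθ').congr_deriv ?_, hθ'⟩
  rw [radialField, polarSlope, div_mul_cancel₀ _ (by rw [← hQ]; exact (hQ0 _).ne')]

end PolarCoordinates

section SlopeEstimates

variable {w D D₁ D₂ θ : ℝ}

lemma abs_two_mul_mul_sin_mul_cos_le (D θ : ℝ) : |2 * D * Real.sin θ * Real.cos θ| ≤ |D| := by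
  have hsin : 2 * D * Real.sin θ * Real.cos θ = D * Real.sin (2 * θ) := by
    rw [Real.sin_two_mul]
    ring
  rw [hsin, abs_mul]
  exact mul_le_of_le_one_right (abs_nonneg D) (Real.abs_sin_le_one _)

lemma angularSpeed_mem_Icc (hD : |D| ≤ w / 16) : angularSpeed w D θ ∈ Icc (w / 2) (3 / 2 * w) := by
  have := abs_le.1 (abs_two_mul_mul_sin_mul_cos_le D θ)
  have := (abs_nonneg D).trans hD
  constructor <;> unfold angularSpeed <;> linarith

lemma angularSpeed_pos (hw : 0 < w) (hD : |D| ≤ w / 16) : 0 < angularSpeed w D θ :=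
  (half_pos hw).trans_le (angularSpeed_mem_Icc hD).1

lemma abs_polarSlope_le (hw : 0 < w) (hD : |D| ≤ w / 16) : |polarSlope w D θ| ≤ 1 / 7 := by
  have hspeed : 15 / 16 * w ≤ angularSpeed w D θ := by
    unfold angularSpeed
    linarith [neg_le_of_abs_le (abs_two_mul_mul_sin_mul_cos_le D θ)]
  have hnum : |2 * D * Real.sin θ ^ 2| ≤ 2 * |D| := by
    rw [abs_mul, abs_mul, abs_two, abs_of_nonneg (sq_nonneg (Real.sin θ))]
    exact mul_le_of_le_one_right (by positivity) (Real.sin_sq_le_one θ)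
  rw [polarSlope, abs_div, abs_of_pos (angularSpeed_pos hw hD),
    div_le_iff₀ (angularSpeed_pos hw hD)]
  linarith

lemma polarSlope_sub_polarSlope (hw : 0 < w) (h₁ : |D₁| ≤ w / 16) (h₂ : |D₂| ≤ w / 16) :
    polarSlope w D₁ θ - polarSlope w D₂ θ =
      2 * Real.sin θ ^ 2 * w / (angularSpeed w D₁ θ * angularSpeed w D₂ θ) * (D₁ - D₂) := by
  have hQ₁ := (angularSpeed_pos (θ := θ) hw h₁).ne'
  have hQ₂ := (angularSpeed_pos (θ := θ) hw h₂).ne'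
  rw [polarSlope, polarSlope, div_sub_div _ _ hQ₁ hQ₂, div_mul_eq_mul_div]
  congr 1
  simp only [angularSpeed]
  ring

lemma polarSlope_le_polarSlope (hw : 0 < w) (h₁ : |D₁| ≤ w / 16) (h₂ : |D₂| ≤ w / 16)
    (h : D₁ ≤ D₂) : polarSlope w D₁ θ ≤ polarSlope w D₂ θ := by
  rw [← sub_nonneg, polarSlope_sub_polarSlope hw h₂ h₁]
  have hQ₁ := angularSpeed_pos (θ := θ) hw h₁
  have hQ₂ := angularSpeed_pos (θ := θ) hw h₂
  have := sub_nonneg.2 h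
  positivity

lemma abs_polarSlope_sub_le (hw : 0 < w) (h₁ : |D₁| ≤ w / 16) (h₂ : |D₂| ≤ w / 16) :
    |polarSlope w D₁ θ - polarSlope w D₂ θ| ≤ 8 / w * |D₁ - D₂| := by
  have hQ₁ := angularSpeed_pos (θ := θ) hw h₁
  have hQ₂ := angularSpeed_pos (θ := θ) hw h₂
  rw [polarSlope_sub_polarSlope hw h₁ h₂, abs_mul, abs_of_nonneg (by positivity)]
  refine mul_le_mul_of_nonneg_right ?_ (abs_nonneg _)
  calc 2 * Real.sin θ ^ 2 * w / (angularSpeed w D₁ θ * angularSpeed w D₂ θ)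
    _ ≤ 2 * 1 * w / (w / 2 * (w / 2)) := by
      gcongr
      exacts [Real.sin_sq_le_one θ, (angularSpeed_mem_Icc h₁).1, (angularSpeed_mem_Icc h₂).1]
    _ = 8 / w := by
      field_simp
      norm_num

lemma polarSlope_pi_div_two (w D : ℝ) : polarSlope w D (Real.pi / 2) = 2 * D / w := by
  simp [polarSlope, angularSpeed]

lemma polarSlope_zero (w θ : ℝ) : polarSlope w 0 θ = 0 := by simp [polarSlope]

end SlopeEstimates

section Clamp

open NNReal

/-- The projection of the real line onto `[-c, c]`, used to truncate nonlinearities. -/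
noncomputable def clamp (c x : ℝ) : ℝ := max (-c) (min c x)

variable {c x : ℝ}

lemma continuous_clamp (c : ℝ) : Continuous (clamp c) := by
  unfold clamp
  fun_prop

lemma abs_clamp_le (hc : 0 ≤ c) (x : ℝ) : |clamp c x| ≤ c :=
  abs_le.2 ⟨le_max_left _ _, max_le (by linarith) (min_le_left _ _)⟩

lemma clamp_eq_self (h : |x| ≤ c) : clamp c x = x := by
  rw [clamp, min_eq_right (abs_le.1 h).2, max_eq_right (abs_le.1 h).1]

lemma clamp_zero (hc : 0 ≤ c) : clamp c 0 = 0 := clamp_eq_self (abs_zero.trans_le hc)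

lemma abs_clamp_sub_clamp_mul_le {s : ℝ} (hc : 0 ≤ c) (hs : s ∈ Icc 0 1) (x : ℝ) :
    |clamp c x - clamp c (s * x)| ≤ c * (1 - s) := by
  obtain ⟨hs₀, hs₁⟩ := hs
  rw [abs_le]
  unfold clamp
  rcases le_total |x| c with hx | hx
  · obtain ⟨h₁, h₂⟩ := abs_le.1 hx
    rw [min_eq_right h₂, max_eq_right h₁, min_eq_right (by nlinarith), max_eq_right (by nlinarith)]
    constructor <;> nlinarith
  rcases le_abs'.1 hx with hx | hx
  · rw [min_eq_right (hx.trans (by linarith)), max_eq_left hx]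
    rw [min_eq_right (by nlinarith)]
    constructor <;> rcases max_cases (-c) (s * x) with h | h <;> nlinarith
  · rw [min_eq_left hx, max_eq_right (by linarith)]
    rw [max_eq_right (le_min (by linarith) (by nlinarith))]
    constructor <;> rcases min_cases c (s * x) with h | h <;> nlinarith

lemma lipschitzWith_clamp_mul_exp (ρ : ℝ≥0) (k : ℝ) :
    LipschitzWith ρ fun σ => clamp ρ (k * Real.exp σ) := by
  refine LipschitzWith.of_dist_le_mul fun σ₁ σ₂ => ?_
  wlog h : σ₁ ≤ σ₂ generalizing σ₁ σ₂
  · rw [dist_comm, dist_comm σ₁]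
    exact this σ₂ σ₁ (le_of_not_ge h)
  have hexp : k * Real.exp σ₁ = Real.exp (σ₁ - σ₂) * (k * Real.exp σ₂) := by
    rw [mul_left_comm, ← Real.exp_add, sub_add_cancel]
  calc |clamp ρ (k * Real.exp σ₁) - clamp ρ (k * Real.exp σ₂)|
    _ ≤ ρ * (1 - Real.exp (σ₁ - σ₂)) := by
      rw [abs_sub_comm, hexp]
      exact abs_clamp_sub_clamp_mul_le ρ.2
        ⟨Real.exp_nonneg _, Real.exp_le_one_iff.2 (sub_nonpos.2 h)⟩ _
    _ ≤ ρ * dist σ₁ σ₂ := by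
      gcongr
      rw [Real.dist_eq, abs_sub_comm, abs_of_nonneg (sub_nonneg.2 h)]
      linarith [Real.add_one_le_exp (σ₁ - σ₂)]

end Clamp

section TameGain

open NNReal

/-- A gain that is small compared with the frequency `w`, vanishes at the equilibrium and is
Lipschitz in the logarithm of the amplitude, uniformly in the direction `k`. Its polar equation is
then globally solvable, and every smooth gain with a zero at the origin can be truncated to a tame
one. -/
structure IsTameGain (G : ℝ → ℝ) (w : ℝ) (K : ℝ≥0) : Prop where
  frequency_pos : 0 < w
  continuous : Continuous G
  abs_apply_le : ∀ y, |G y| ≤ w / 32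
  map_zero : G 0 = 0
  lipschitz : ∀ k, LipschitzWith K fun σ => G (k * Real.exp σ)

lemma exists_isTameGain_eqOn {g : ℝ → ℝ} {w : ℝ} (hw : 0 < w) (hg : ContDiff ℝ 1 g)
    (hg0 : g 0 = 0) : ∃ ρ > 0, ∃ G K, IsTameGain G w K ∧ EqOn G g (Icc (-ρ) ρ) := by
  obtain ⟨K, s, hs, hlip⟩ := hg.contDiffAt.exists_lipschitzOnWith (x := 0)
  have small : ∀ᶠ y in 𝓝 0, |g y| < w / 32 :=
    hg.continuous.abs.continuousAt.eventually_lt continuousAt_const (by simpa [hg0] using hw)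
  obtain ⟨ρ, hρ, hsub⟩ := Metric.nhds_basis_closedBall.mem_iff.1 (inter_mem hs small)
  rw [Real.closedBall_eq_Icc, zero_sub, zero_add] at hsub
  have clamp_mem (y : ℝ) : clamp ρ y ∈ Icc (-ρ) ρ := abs_le.1 (abs_clamp_le hρ.le y)
  have hlipρ : LipschitzOnWith K g (Icc (-ρ) ρ) := hlip.mono fun y hy => (hsub hy).1
  refine ⟨ρ, hρ, fun y => g (clamp ρ y), K * ⟨ρ, hρ.le⟩, ⟨hw, ?_, ?_, ?_, fun k => ?_⟩, ?_⟩
  · exact hg.continuous.comp (continuous_clamp ρ)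
  · exact fun y => (hsub (clamp_mem y)).2.le
  · rw [clamp_eq_self (by simpa using hρ.le), hg0]
  · exact lipschitzOnWith_univ.1 (hlipρ.comp
      (lipschitzWith_clamp_mul_exp ⟨ρ, hρ.le⟩ k).lipschitzOnWith fun σ _ => clamp_mem _)
  · exact fun y hy => congrArg g (clamp_eq_self (abs_le.2 hy))

end TameGain

section BlowUp

open NNReal

/-- The total gain at the angle `θ` and the radius `x * exp σ`. The clamped parameter keeps it small
for all values of the arguments. -/
noncomputable def blowUpGain (G : ℝ → ℝ) (w x γ θ σ : ℝ) : ℝ :=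
  clamp (w / 32) γ + G (x * Real.cos θ * Real.exp σ)

/-- The radial equation for the logarithm `σ` of the radius relative to the initial radius `x`. In
contrast to `radialField` it extends to `x = 0`, where it is the linearized radial equation. -/
noncomputable def blowUpField (G : ℝ → ℝ) (w x γ θ σ : ℝ) : ℝ :=
  polarSlope w (blowUpGain G w x γ θ σ) θ

/-- The solution of the equation of `blowUpField` that starts at `0`. -/
noncomputable def blowUpFlow (G : ℝ → ℝ) (w x γ : ℝ) : ℝ → ℝ :=
  Classical.epsilon fun σ => σ 0 = 0 ∧ IsIntegralCurve σ (blowUpField G w x γ)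

/-- The logarithm of the ratio between the Poincaré return and the initial radius `x`. -/
noncomputable def displacement (G : ℝ → ℝ) (w x γ : ℝ) : ℝ := blowUpFlow G w x γ (2 * Real.pi)

/-- The time of one turn around the equilibrium, starting at the radius `x`. -/
noncomputable def turnTime (G : ℝ → ℝ) (w x γ : ℝ) : ℝ :=
  ∫ θ in 0..2 * Real.pi, (angularSpeed w (blowUpGain G w x γ θ (blowUpFlow G w x γ θ)) θ)⁻¹

namespace IsTameGain

variable {G : ℝ → ℝ} {w x γ : ℝ} {K : ℝ≥0}

lemma abs_blowUpGain_le (h : IsTameGain G w K) (x γ θ σ : ℝ) :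
    |blowUpGain G w x γ θ σ| ≤ w / 16 := by
  have hclamp := abs_clamp_le (by linarith [h.frequency_pos] : 0 ≤ w / 32) γ
  have hG := h.abs_apply_le (x * Real.cos θ * Real.exp σ)
  rw [blowUpGain]
  linarith [abs_add_le (clamp (w / 32) γ) (G (x * Real.cos θ * Real.exp σ))]

lemma continuous_blowUpGain (h : IsTameGain G w K) : Continuous fun q : (ℝ × ℝ) × ℝ × ℝ =>
    blowUpGain G w q.1.1 q.1.2 q.2.1 q.2.2 := by
  have := h.continuous
  have := continuous_clamp (w / 32)
  unfold blowUpGain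
  fun_prop

lemma continuous_blowUpField (h : IsTameGain G w K) : Continuous fun q : (ℝ × ℝ) × ℝ × ℝ =>
    blowUpField G w q.1.1 q.1.2 q.2.1 q.2.2 := by
  have := h.continuous_blowUpGain
  unfold blowUpField polarSlope
  refine Continuous.div (by fun_prop) ?_ fun q =>
    (angularSpeed_pos h.frequency_pos (h.abs_blowUpGain_le _ _ _ _)).ne'
  unfold angularSpeed
  fun_prop

lemma abs_blowUpField_le (h : IsTameGain G w K) (x γ θ σ : ℝ) :
    |blowUpField G w x γ θ σ| ≤ 1 / 7 :=
  abs_polarSlope_le h.frequency_pos (h.abs_blowUpGain_le x γ θ σ)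

lemma lipschitzWith_blowUpField (h : IsTameGain G w K) (x γ θ : ℝ) :
    LipschitzWith (Real.toNNReal (8 / w) * K) (blowUpField G w x γ θ) := by
  have hw := h.frequency_pos
  refine LipschitzWith.of_dist_le_mul fun σ₁ σ₂ => ?_
  calc |blowUpField G w x γ θ σ₁ - blowUpField G w x γ θ σ₂|
    _ ≤ 8 / w * |blowUpGain G w x γ θ σ₁ - blowUpGain G w x γ θ σ₂| :=
      abs_polarSlope_sub_le hw (h.abs_blowUpGain_le x γ θ σ₁) (h.abs_blowUpGain_le x γ θ σ₂)
    _ ≤ 8 / w * (K * dist σ₁ σ₂) := by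
      rw [blowUpGain, blowUpGain, add_sub_add_left_eq_sub]
      gcongr
      exact (h.lipschitz _).dist_le_mul σ₁ σ₂
    _ = ↑(Real.toNNReal (8 / w) * K) * dist σ₁ σ₂ := by
      rw [NNReal.coe_mul, Real.coe_toNNReal _ (by positivity), mul_assoc]

lemma exists_isIntegralCurve_blowUpField (h : IsTameGain G w K) (x γ : ℝ) :
    ∃ σ : ℝ → ℝ, σ 0 = 0 ∧ IsIntegralCurve σ (blowUpField G w x γ) :=
  exists_isIntegralCurve_of_lipschitz_of_bounded (M := 1 / 7) (h.lipschitzWith_blowUpField x γ)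
    (fun σ => h.continuous_blowUpField.comp (f := fun θ => ((x, γ), θ, σ)) (by fun_prop))
    (fun θ σ => by simpa using h.abs_blowUpField_le x γ θ σ) 0

lemma blowUpFlow_zero (h : IsTameGain G w K) (x γ : ℝ) : blowUpFlow G w x γ 0 = 0 :=
  (Classical.epsilon_spec (h.exists_isIntegralCurve_blowUpField x γ)).1

lemma isIntegralCurve_blowUpFlow (h : IsTameGain G w K) (x γ : ℝ) :
    IsIntegralCurve (blowUpFlow G w x γ) (blowUpField G w x γ) :=
  (Classical.epsilon_spec (h.exists_isIntegralCurve_blowUpField x γ)).2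

lemma eq_blowUpFlow (h : IsTameGain G w K) {σ : ℝ → ℝ}
    (hσ : IsIntegralCurve σ (blowUpField G w x γ)) (h0 : σ 0 = 0) : σ = blowUpFlow G w x γ :=
  integralCurve_eq_of_lipschitz (h.lipschitzWith_blowUpField x γ) hσ
    (h.isIntegralCurve_blowUpFlow x γ) (h0.trans (h.blowUpFlow_zero x γ).symm)

lemma continuous_blowUpFlow (h : IsTameGain G w K) {θ : ℝ} (hθ : 0 ≤ θ) :
    Continuous fun q : ℝ × ℝ => blowUpFlow G w q.1 q.2 θ :=
  continuous_integralCurve_parameter (P := ℝ × ℝ) (v := fun q => blowUpField G w q.1 q.2)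
    (y := fun q => blowUpFlow G w q.1 q.2) (fun q => h.lipschitzWith_blowUpField q.1 q.2)
    h.continuous_blowUpField (fun q => h.isIntegralCurve_blowUpFlow q.1 q.2)
    (fun q => h.blowUpFlow_zero q.1 q.2) hθ

lemma abs_blowUpFlow_le (h : IsTameGain G w K) (x γ : ℝ) {θ : ℝ} (hθ : 0 ≤ θ) :
    |blowUpFlow G w x γ θ| ≤ 1 / 7 * θ := by
  have := convex_univ.norm_image_sub_le_of_norm_hasDerivWithin_le (x := 0) (y := θ)
    (fun s _ => (h.isIntegralCurve_blowUpFlow x γ s).hasDerivWithinAt)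
    (fun s _ => h.abs_blowUpField_le x γ s _) (mem_univ _) (mem_univ _)
  simpa [h.blowUpFlow_zero, abs_of_nonneg hθ] using this

lemma blowUpFlow_zero_zero (h : IsTameGain G w K) : blowUpFlow G w 0 0 = 0 := by
  refine (h.eq_blowUpFlow (fun θ => ?_) rfl).symm
  have hw : (0 : ℝ) ≤ w / 32 := by linarith [h.frequency_pos]
  refine (hasDerivAt_const θ (0 : ℝ)).congr_deriv ?_
  simp [blowUpField, blowUpGain, h.map_zero, clamp_zero hw, polarSlope_zero]

lemma blowUpField_pi_div_two (h : IsTameGain G w K) (x γ σ : ℝ) :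
    blowUpField G w x γ (Real.pi / 2) σ = 2 * clamp (w / 32) γ / w := by
  simp [blowUpField, blowUpGain, polarSlope_pi_div_two, h.map_zero]

lemma displacement_lt_displacement (h : IsTameGain G w K) (x : ℝ) {γ₁ γ₂ : ℝ}
    (hγ : clamp (w / 32) γ₁ < clamp (w / 32) γ₂) :
    displacement G w x γ₁ < displacement G w x γ₂ := by
  have hw := h.frequency_pos
  refine lt_of_deriv_le_of_lipschitz (y := blowUpFlow G w x γ₁) (z := blowUpFlow G w x γ₂)
    (c := Real.pi / 2) (h.lipschitzWith_blowUpField x γ₂)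
    (h.isIntegralCurve_blowUpFlow x γ₁) (h.isIntegralCurve_blowUpFlow x γ₂) (fun θ => ?_)
    (by rw [h.blowUpFlow_zero, h.blowUpFlow_zero])
    ⟨Real.pi_div_two_pos, by linarith [Real.pi_pos]⟩ ?_
  · exact polarSlope_le_polarSlope hw (h.abs_blowUpGain_le _ _ _ _) (h.abs_blowUpGain_le _ _ _ _)
      (add_le_add_left hγ.le _)
  · rw [h.blowUpField_pi_div_two, h.blowUpField_pi_div_two]
    gcongr

lemma strictMonoOn_displacement (h : IsTameGain G w K) (x : ℝ) :
    StrictMonoOn (displacement G w x) (Icc (-(w / 32)) (w / 32)) := fun γ₁ h₁ γ₂ h₂ hγ =>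
  h.displacement_lt_displacement x <| by
    rwa [clamp_eq_self (abs_le.2 h₁), clamp_eq_self (abs_le.2 h₂)]

lemma displacement_neg (h : IsTameGain G w K) (x : ℝ) : displacement G w x (-(w / 32)) < 0 := by
  have hw := h.frequency_pos
  have hclamp : clamp (w / 32) (-(w / 32)) = -(w / 32) :=
    clamp_eq_self (by rw [abs_neg, abs_of_pos (by positivity)])
  refine lt_of_deriv_le_of_lipschitz (y := blowUpFlow G w x (-(w / 32))) (z := fun _ => 0)
    (v := fun _ _ => 0) (K := 0) (c := Real.pi / 2)
    (fun _ => LipschitzWith.const 0) (h.isIntegralCurve_blowUpFlow x _)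
    (fun θ => hasDerivAt_const θ 0) (fun θ => ?_) (h.blowUpFlow_zero x _).le
    ⟨Real.pi_div_two_pos, by linarith [Real.pi_pos]⟩ ?_
  · refine (polarSlope_le_polarSlope hw (h.abs_blowUpGain_le _ _ _ _)
      (by rw [abs_zero]; positivity) ?_).trans_eq (polarSlope_zero w θ)
    rw [blowUpGain, hclamp, neg_add_nonpos_iff]
    exact (le_abs_self _).trans (h.abs_apply_le _)
  · rw [h.blowUpField_pi_div_two, hclamp, div_neg_iff]
    exact Or.inr ⟨by linarith, hw⟩

lemma displacement_pos (h : IsTameGain G w K) (x : ℝ) : 0 < displacement G w x (w / 32) := by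
  have hw := h.frequency_pos
  have hclamp : clamp (w / 32) (w / 32) = w / 32 :=
    clamp_eq_self (by rw [abs_of_pos (by positivity)])
  refine lt_of_deriv_le_of_lipschitz (y := fun _ => 0) (y' := fun _ => 0)
    (z := blowUpFlow G w x (w / 32)) (c := Real.pi / 2)
    (h.lipschitzWith_blowUpField x _) (fun θ => hasDerivAt_const θ 0)
    (h.isIntegralCurve_blowUpFlow x _) (fun θ => ?_) (h.blowUpFlow_zero x _).ge
    ⟨Real.pi_div_two_pos, by linarith [Real.pi_pos]⟩ ?_
  · refine (polarSlope_zero w θ).symm.trans_le (polarSlope_le_polarSlope hw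
      (by rw [abs_zero]; positivity) (h.abs_blowUpGain_le _ _ _ _) ?_)
    rw [blowUpGain, hclamp]
    linarith [abs_le.1 (h.abs_apply_le (x * Real.cos θ * Real.exp 0))]
  · rw [h.blowUpField_pi_div_two, hclamp]
    positivity

lemma exists_continuous_displacement_eq_zero_iff (h : IsTameGain G w K) : ∃ μ : ℝ → ℝ,
    Continuous μ ∧ μ 0 = 0 ∧ ∀ x, μ x ∈ Ioo (-(w / 32)) (w / 32) ∧
      ∀ γ ∈ Icc (-(w / 32)) (w / 32), displacement G w x γ = 0 ↔ γ = μ x := by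
  have hw := h.frequency_pos
  have continuous_displacement := h.continuous_blowUpFlow (θ := 2 * Real.pi) (by positivity)
  obtain ⟨μ, hμ, hμ_zero⟩ := exists_continuousOn_zero_of_strictMonoOn (s := univ)
    (F := displacement G w) (by linarith : -(w / 32) ≤ w / 32)
    (fun γ _ => (continuous_displacement.comp (f := (·, γ)) (by fun_prop)).continuousOn)
    (fun x _ => (continuous_displacement.comp (f := (x, ·)) (by fun_prop)).continuousOn)
    (fun x _ => h.strictMonoOn_displacement x) (fun x _ => h.displacement_neg x)
    (fun x _ => h.displacement_pos x)
  have unique (x : ℝ) {γ : ℝ} (hγ : γ ∈ Icc (-(w / 32)) (w / 32)) :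
      displacement G w x γ = 0 ↔ γ = μ x := by
    obtain ⟨hmem, hzero⟩ := hμ_zero x (mem_univ x)
    rw [← hzero]
    exact (h.strictMonoOn_displacement x).injOn.eq_iff hγ (Ioo_subset_Icc_self hmem)
  refine ⟨μ, continuousOn_univ.1 hμ, ((unique 0 ⟨by linarith, by linarith⟩).1 ?_).symm,
    fun x => ⟨(hμ_zero x (mem_univ x)).1, fun γ => unique x⟩⟩
  rw [displacement, h.blowUpFlow_zero_zero, Pi.zero_apply]

lemma continuous_inv_angularSpeed (h : IsTameGain G w K) {X : Type*} [TopologicalSpace X]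
    {q : X → ℝ × ℝ} {θ σ : X → ℝ} (hq : Continuous q) (hθ : Continuous θ) (hσ : Continuous σ) :
    Continuous fun p => (angularSpeed w (blowUpGain G w (q p).1 (q p).2 (θ p) (σ p)) (θ p))⁻¹ := by
  refine Continuous.inv₀ ?_ fun p =>
    (angularSpeed_pos h.frequency_pos (h.abs_blowUpGain_le _ _ _ _)).ne'
  have := h.continuous_blowUpGain.comp (hq.prodMk (hθ.prodMk hσ))
  unfold angularSpeed
  fun_prop

lemma continuous_turnTime (h : IsTameGain G w K) :
    Continuous fun q : ℝ × ℝ => turnTime G w q.1 q.2 := by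
  have hw := h.frequency_pos
  refine intervalIntegral.continuous_of_dominated_interval (bound := fun _ => (w / 2)⁻¹)
    (fun q => ?_) (fun q => .of_forall fun θ _ => ?_) intervalIntegrable_const
    (.of_forall fun θ hθ => ?_)
  · exact (h.continuous_inv_angularSpeed continuous_const continuous_id
      (h.isIntegralCurve_blowUpFlow q.1 q.2).continuous).aestronglyMeasurable
  · have hspeed := (angularSpeed_mem_Icc (θ := θ)
      (h.abs_blowUpGain_le q.1 q.2 θ (blowUpFlow G w q.1 q.2 θ))).1
    rw [Real.norm_of_nonneg (inv_nonneg.2 ((half_pos hw).le.trans hspeed))]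
    exact inv_anti₀ (half_pos hw) hspeed
  · rw [uIoc_of_le (by positivity)] at hθ
    exact h.continuous_inv_angularSpeed continuous_id continuous_const
      (h.continuous_blowUpFlow hθ.1.le)

lemma turnTime_zero_zero (h : IsTameGain G w K) : turnTime G w 0 0 = 2 * Real.pi / w := by
  have hw : (0 : ℝ) ≤ w / 32 := by linarith [h.frequency_pos]
  have gain_zero (θ σ : ℝ) : blowUpGain G w 0 0 θ σ = 0 := by
    rw [blowUpGain, clamp_zero hw, zero_mul, zero_mul, h.map_zero, add_zero]
  simp [turnTime, gain_zero, angularSpeed, div_eq_mul_inv]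

end IsTameGain

end BlowUp

section PeriodicOrbits

open NNReal

lemma exists_winding_number_of_exp_eq {R θ : ℝ → ℝ} (hθ : StrictMono θ) {t τ : ℝ} (hτ : 0 < τ)
    (h : Complex.exp ⟨R (t + τ), θ (t + τ)⟩ = Complex.exp ⟨R t, θ t⟩) :
    ∃ n : ℕ, 0 < n ∧ R (t + τ) = R t ∧ θ (t + τ) = θ t + n * (2 * Real.pi) := by
  obtain ⟨n, hn⟩ := Complex.exp_eq_exp_iff_exists_int.1 h
  have hre : R (t + τ) = R t := by simpa using congrArg Complex.re hn
  have him : θ (t + τ) = θ t + n * (2 * Real.pi) := by simpa using congrArg Complex.im hn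
  have n_pos : (0 : ℝ) < n :=
    pos_of_mul_pos_left (by linarith [hθ (lt_add_of_pos_right t hτ)]) Real.two_pi_pos.le
  lift n to ℕ using by exact_mod_cast n_pos.le
  exact ⟨n, by exact_mod_cast n_pos, hre, by exact_mod_cast him⟩

lemma isLeast_period_exp {R θ : ℝ → ℝ} {T : ℝ} (hθ : StrictMono θ) (hR : Function.Periodic R T)
    (hT : ∀ t, θ (t + T) = θ t + 2 * Real.pi) :
    IsLeast {τ | 0 < τ ∧ Function.Periodic (fun t => Complex.exp ⟨R t, θ t⟩) τ} T := by
  refine ⟨⟨?_, fun t => ?_⟩, fun τ ⟨hτ, hper⟩ => ?_⟩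
  · have turn : θ 0 < θ (0 + T) := by linarith [hT 0, Real.two_pi_pos]
    exact pos_of_lt_add_right (hθ.lt_iff_lt.1 turn)
  · refine Complex.exp_eq_exp_iff_exists_int.2 ⟨1, Complex.ext ?_ ?_⟩
    · simp [hR t]
    · simp [hT t]
  · obtain ⟨n, hn, -, hθτ⟩ := exists_winding_number_of_exp_eq hθ hτ (hper 0)
    refine (add_le_add_iff_left 0).1 (hθ.le_iff_le.1 ?_)
    rw [hT, hθτ]
    exact add_le_add le_rfl (le_mul_of_one_le_left Real.two_pi_pos.le (Nat.one_le_cast.2 hn))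

lemma IsPolarSolution.strictMono {g : ℝ → ℝ} {w γ : ℝ} {R θ : ℝ → ℝ}
    (h : IsPolarSolution g w γ R θ)
    (hspeed : ∀ t, 0 < angularSpeed w (γ + g (Real.exp (R t) * Real.cos (θ t))) (θ t)) :
    StrictMono θ :=
  strictMono_of_hasDerivAt_pos (fun t => (h t).2) hspeed

namespace IsTameGain

variable {G : ℝ → ℝ} {w x γ : ℝ} {K : ℝ≥0}

lemma abs_add_apply_le (h : IsTameGain G w K) (hγ : |γ| ≤ w / 32) (y : ℝ) :
    |γ + G y| ≤ w / 16 := by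
  linarith [abs_add_le γ (G y), h.abs_apply_le y]

lemma blowUpField_eq_radialField (hx : 0 < x) (hγ : |γ| ≤ w / 32) (θ σ : ℝ) :
    blowUpField G w x γ θ σ = radialField G w γ θ (Real.log x + σ) := by
  rw [blowUpField, radialField, blowUpGain, clamp_eq_self hγ, Real.exp_add, Real.exp_log hx,
    mul_right_comm]

lemma blowUpField_add_two_pi (x γ θ : ℝ) :
    blowUpField G w x γ (θ + 2 * Real.pi) = blowUpField G w x γ θ := by
  ext σ
  simp only [blowUpField, blowUpGain, polarSlope, angularSpeed, Real.sin_add_two_pi,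
    Real.cos_add_two_pi]

lemma periodic_blowUpFlow (h : IsTameGain G w K) (hx : displacement G w x γ = 0) :
    Function.Periodic (blowUpFlow G w x γ) (2 * Real.pi) :=
  periodic_integralCurve_of_eq (h.lipschitzWith_blowUpField x γ) (blowUpField_add_two_pi x γ)
    (h.isIntegralCurve_blowUpFlow x γ) (t₀ := 0)
    (by rw [zero_add, h.blowUpFlow_zero]; exact hx)

lemma abs_blowUpFlow_le_one (h : IsTameGain G w K) (hx : displacement G w x γ = 0) (θ : ℝ) :
    |blowUpFlow G w x γ θ| ≤ 1 := by
  obtain ⟨s, hs, hθs⟩ := (h.periodic_blowUpFlow hx).exists_mem_Ico₀ Real.two_pi_pos θ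
  rw [hθs]
  linarith [h.abs_blowUpFlow_le x γ hs.1, hs.2, Real.pi_lt_d2]

lemma exists_isPolarSolution_of_displacement_eq_zero (h : IsTameGain G w K) (hx : 0 < x)
    (hγ : |γ| ≤ w / 32) (hxγ : displacement G w x γ = 0) : ∃ θ : ℝ → ℝ, θ 0 = 0 ∧
      IsPolarSolution G w γ (fun t => Real.log x + blowUpFlow G w x γ (θ t)) θ ∧
      ∀ t, θ (t + turnTime G w x γ) = θ t + 2 * Real.pi := by
  have isIntegralCurve_log_radius :
      IsIntegralCurve (fun s => Real.log x + blowUpFlow G w x γ s) (radialField G w γ) := fun s =>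
    ((h.isIntegralCurve_blowUpFlow x γ s).const_add _).congr_deriv
      (blowUpField_eq_radialField hx hγ s _)
  let Q (s : ℝ) : ℝ := angularSpeed w (blowUpGain G w x γ s (blowUpFlow G w x γ s)) s
  have hQ (s : ℝ) : Q s ∈ Icc (w / 2) (3 / 2 * w) := angularSpeed_mem_Icc (h.abs_blowUpGain_le ..)
  obtain ⟨θ, hpolar, hθ, htime⟩ := exists_isPolarSolution_of_isIntegralCurve_radialField
    h.continuous isIntegralCurve_log_radius (half_pos h.frequency_pos) (Q := Q)
    (fun s => by
      simp only [Q, blowUpGain, clamp_eq_self hγ, Real.exp_add, Real.exp_log hx, mul_right_comm])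
    (fun s => (hQ s).1) (fun s => (hQ s).2)
  have periodic_Q : Function.Periodic (fun s => (Q s)⁻¹) (2 * Real.pi) := fun s => by
    simp only [Q, blowUpGain, angularSpeed, Real.sin_add_two_pi, Real.cos_add_two_pi,
      h.periodic_blowUpFlow hxγ s]
  refine ⟨θ, by simpa using hθ 0, hpolar, fun t => ?_⟩
  have htime_add : ∫ u in 0..θ t + 2 * Real.pi, (Q u)⁻¹ = t + turnTime G w x γ := by
    have continuous_inv : Continuous fun s => (Q s)⁻¹ :=
      h.continuous_inv_angularSpeed (q := fun _ => (x, γ)) continuous_const continuous_id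
        (h.isIntegralCurve_blowUpFlow x γ).continuous
    rw [periodic_Q.intervalIntegral_add_eq_add 0 (θ t)
      (fun s₁ s₂ => continuous_inv.intervalIntegrable s₁ s₂), htime, zero_add, turnTime]
  rw [← htime_add, hθ]

lemma exists_periodicOrbit (h : IsTameGain G w K) (hx : 0 < x) (hγ : |γ| ≤ w / 32)
    (hxγ : displacement G w x γ = 0) : ∃ y : ℝ → Fin 2 → ℝ, y 0 = ![x, 0] ∧
      IsIntegralCurve y (fun _ => lienardField G (w ^ 2) γ) ∧
      IsLeast {τ | 0 < τ ∧ Function.Periodic y τ} (turnTime G w x γ) ∧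
      ∀ t, ‖y t‖ ≤ max 1 w * (Real.exp 1 * x) := by
  have hw := h.frequency_pos
  obtain ⟨θ, hθ0, hpolar, hθ⟩ := h.exists_isPolarSolution_of_displacement_eq_zero hx hγ hxγ
  have strictMono_θ : StrictMono θ :=
    hpolar.strictMono fun t => angularSpeed_pos hw (h.abs_add_apply_le hγ _)
  have hleast := isLeast_period_exp strictMono_θ
    (R := fun t => Real.log x + blowUpFlow G w x γ (θ t))
    (fun t => by simp only [hθ, h.periodic_blowUpFlow hxγ (θ t)]) hθ
  refine ⟨fun t => planeOfComplex w
      (Complex.exp ⟨Real.log x + blowUpFlow G w x γ (θ t), θ t⟩), ?_,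
    (isIntegralCurve_planeOfComplex_iff hw.ne').2 hpolar.isIntegralCurve_exp, ?_, fun t => ?_⟩
  · simp [planeOfComplex, hθ0, h.blowUpFlow_zero, Complex.exp_re, Complex.exp_im, Real.exp_log hx]
  · simpa only [Function.Periodic, (planeOfComplex_injective hw.ne').eq_iff] using hleast
  · refine (norm_planeOfComplex_le hw.le _).trans ?_
    gcongr
    rw [Complex.norm_exp, add_comm, Real.exp_add, Real.exp_log hx]
    gcongr
    exact (le_abs_self _).trans (h.abs_blowUpFlow_le_one hxγ _)

lemma exists_displacement_eq_zero (h : IsTameGain G w K) (hγ : |γ| ≤ w / 32) {z : ℝ → ℂ}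
    (hz : IsIntegralCurve z fun _ => complexLienardField G w γ) (h0 : ∀ t, z t ≠ 0) {τ : ℝ}
    (hτ : 0 < τ) (hper : Function.Periodic z τ) :
    ∃ x > 0, displacement G w x γ = 0 ∧ (x : ℂ) ∈ range z := by
  have hw := h.frequency_pos
  obtain ⟨R, θ, hpolar, hzexp⟩ := exists_isPolarSolution h.continuous hz h0
  have hspeed (t : ℝ) : w / 2 ≤ angularSpeed w (γ + G (Real.exp (R t) * Real.cos (θ t))) (θ t) :=
    (angularSpeed_mem_Icc (h.abs_add_apply_le hγ _)).1
  obtain ⟨time, htime, hθ, hradial⟩ :=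
    hpolar.exists_isIntegralCurve_radialField (half_pos hw) hspeed
  obtain ⟨n, hn, hRn, hθn⟩ := exists_winding_number_of_exp_eq
    (hpolar.strictMono fun t => (half_pos hw).trans_le (hspeed t)) hτ
    (R := R) (t := time 0) (by rw [← hzexp, ← hzexp, hper])
  have flow_eq : (fun s => R (time s) - R (time 0)) =
      blowUpFlow G w (Real.exp (R (time 0))) γ := by
    refine h.eq_blowUpFlow (fun s => ((hradial s).sub_const _).congr_deriv ?_) (sub_self _)
    rw [blowUpField_eq_radialField (Real.exp_pos _) hγ, Real.log_exp, add_sub_cancel]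
  have flow_return : blowUpFlow G w (Real.exp (R (time 0))) γ (0 + n * (2 * Real.pi)) =
      blowUpFlow G w (Real.exp (R (time 0))) γ 0 := by
    rw [hθ] at hθn
    simp only [← flow_eq, ← hθn, htime, hRn]
  refine ⟨Real.exp (R (time 0)), Real.exp_pos _, ?_, time 0, ?_⟩
  · have := periodic_integralCurve_of_eq_add_nsmul (h.lipschitzWith_blowUpField _ γ)
      (blowUpField_add_two_pi _ γ) (h.isIntegralCurve_blowUpFlow _ γ) hn flow_return 0
    rwa [zero_add, h.blowUpFlow_zero] at this
  · rw [hzexp, hθ, Complex.ofReal_exp]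
    rfl

lemma exists_displacement_eq_zero_of_periodicOrbit (h : IsTameGain G w K) (hγ : |γ| ≤ w / 32)
    {y : ℝ → Fin 2 → ℝ} (hy : IsIntegralCurve y fun _ => lienardField G (w ^ 2) γ)
    (h0 : ∀ t, y t ≠ 0) {τ : ℝ} (hτ : 0 < τ) (hper : Function.Periodic y τ) :
    ∃ x > 0, displacement G w x γ = 0 ∧ ![x, 0] ∈ range y := by
  have hw := h.frequency_pos.ne'
  choose z hz using fun t => exists_planeOfComplex_eq hw (y t)
  obtain rfl : (fun t => planeOfComplex w (z t)) = y := funext hz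
  obtain ⟨x, hx, hxγ, t, hzt⟩ := h.exists_displacement_eq_zero hγ
    ((isIntegralCurve_planeOfComplex_iff hw).1 hy)
    (fun t hzt => h0 t (by simp only [hzt, planeOfComplex_zero])) hτ
    fun t => planeOfComplex_injective hw (hper t)
  exact ⟨x, hx, hxγ, t, by simp [hzt, planeOfComplex]⟩

lemma exists_periodicOrbit_family (h : IsTameGain G w K) :
    ∃ (μ T : ℝ → ℝ) (Y : ℝ → ℝ → Fin 2 → ℝ), Continuous μ ∧ Continuous T ∧ μ 0 = 0 ∧
      T 0 = 2 * Real.pi / w ∧ (∀ x, Y x 0 = ![x, 0]) ∧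
      (∀ x > 0, IsIntegralCurve (Y x) (fun _ => lienardField G (w ^ 2) (μ x)) ∧
        IsLeast {τ | 0 < τ ∧ Function.Periodic (Y x) τ} (T x) ∧
        ∀ t, ‖Y x t‖ ≤ max 1 w * (Real.exp 1 * x)) ∧
      ∀ (γ : ℝ) (y : ℝ → Fin 2 → ℝ), |γ| ≤ w / 32 →
        IsIntegralCurve y (fun _ => lienardField G (w ^ 2) γ) → (∀ t, y t ≠ 0) →
        (∃ τ > 0, Function.Periodic y τ) → ∃ x > 0, μ x = γ ∧ ![x, 0] ∈ range y := by
  obtain ⟨μ, hμ, hμ0, hμ_iff⟩ := h.exists_continuous_displacement_eq_zero_iff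
  have orbit (x : ℝ) : ∃ y : ℝ → Fin 2 → ℝ, y 0 = ![x, 0] ∧ (x > 0 →
      IsIntegralCurve y (fun _ => lienardField G (w ^ 2) (μ x)) ∧
      IsLeast {τ | 0 < τ ∧ Function.Periodic y τ} (turnTime G w x (μ x)) ∧
      ∀ t, ‖y t‖ ≤ max 1 w * (Real.exp 1 * x)) := by
    obtain hx | hx := le_or_gt x 0
    · exact ⟨fun _ => ![x, 0], rfl, fun h => absurd h hx.not_gt⟩
    have hμx := Ioo_subset_Icc_self (hμ_iff x).1
    obtain ⟨y, hy0, hy⟩ := h.exists_periodicOrbit hx (abs_le.2 hμx) (((hμ_iff x).2 _ hμx).2 rfl)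
    exact ⟨y, hy0, fun _ => hy⟩
  choose Y hY0 hY using orbit
  refine ⟨μ, fun x => turnTime G w x (μ x), Y, hμ,
    h.continuous_turnTime.comp (f := fun x => (x, μ x)) (by fun_prop), hμ0,
    by simp only [hμ0, h.turnTime_zero_zero], hY0, hY, fun γ y hγ hy hy0 ⟨τ, hτ, hper⟩ => ?_⟩
  obtain ⟨x, hx, hxγ, hmem⟩ := h.exists_displacement_eq_zero_of_periodicOrbit hγ hy hy0 hτ hper
  exact ⟨x, hx, (((hμ_iff x).2 γ (abs_le.1 hγ)).1 hxγ).symm, hmem⟩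

end IsTameGain

end PeriodicOrbits

section HopfBifurcation

variable {g G : ℝ → ℝ} {w k γ ρ : ℝ}

lemma isIntegralCurve_lienardField_congr (hG : EqOn G g (Icc (-ρ) ρ)) {y : ℝ → Fin 2 → ℝ}
    (hy : ∀ t, ‖y t‖ ≤ ρ) : IsIntegralCurve y (fun _ => lienardField G k γ) ↔
      IsIntegralCurve y fun _ => lienardField g k γ := by
  have field_eq (t : ℝ) : lienardField G k γ (y t) = lienardField g k γ (y t) := by
    simp only [lienardField, hG (abs_le.1 ((norm_le_pi_norm (y t) 0).trans (hy t)))]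
  simp only [IsIntegralCurve, field_eq]

lemma exists_periodicOrbit_family_lienardField (hg : ContDiff ℝ 1 g) (hg0 : g 0 = 0)
    (hw : 0 < w) : ∃ ε₀ > 0, ∃ (μ T : ℝ → ℝ) (Y : ℝ → ℝ → Fin 2 → ℝ),
      Continuous μ ∧ Continuous T ∧ μ 0 = 0 ∧ T 0 = 2 * Real.pi / w ∧ (∀ x, Y x 0 = ![x, 0]) ∧
      (∀ x ∈ Ioo 0 ε₀, IsIntegralCurve (Y x) (fun _ => lienardField g (w ^ 2) (μ x)) ∧
        IsLeast {τ | 0 < τ ∧ Function.Periodic (Y x) τ} (T x) ∧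
        ∀ t, ‖Y x t‖ ≤ max 1 w * (Real.exp 1 * x)) ∧
      ∀ (γ : ℝ) (y : ℝ → Fin 2 → ℝ), |γ| ≤ w / 32 →
        IsIntegralCurve y (fun _ => lienardField g (w ^ 2) γ) →
        (∃ τ > 0, Function.Periodic y τ) → (¬∃ u, ∀ t, y t = u) → (∀ t, ‖y t‖ < ε₀) →
          ∃ x ∈ Ioo 0 ε₀, μ x = γ ∧ ![x, 0] ∈ range y := by
  obtain ⟨ρ, hρ, G, K, hG, hGg⟩ := exists_isTameGain_eqOn hw hg hg0
  obtain ⟨μ, T, Y, hμ, hT, hμ0, hT0, hY0, hY, exhausts⟩ := hG.exists_periodicOrbit_family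
  have one_le : 1 ≤ max 1 w * Real.exp 1 :=
    one_le_mul_of_one_le_of_one_le (le_max_left 1 w) (Real.one_le_exp zero_le_one)
  refine ⟨ρ / (max 1 w * Real.exp 1), by positivity, μ, T, Y, hμ, hT, hμ0, hT0, hY0,
    fun x hx => ?_, fun γ y hγ hy hper hconst hyr => ?_⟩
  · obtain ⟨hcurve, hperiod, hnorm⟩ := hY x hx.1
    refine ⟨(isIntegralCurve_lienardField_congr hGg fun t => (hnorm t).trans ?_).1 hcurve,
      hperiod, hnorm⟩
    rw [← mul_assoc]
    exact ((lt_div_iff₀' (by positivity)).1 hx.2).le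
  · have hyρ (t : ℝ) : ‖y t‖ ≤ ρ := (hyr t).le.trans (div_le_self hρ.le one_le)
    have hy0 : ∀ t, y t ≠ 0 := integralCurve_ne_of_not_constant
      ((contDiff_lienardField hg (w ^ 2)).comp (contDiff_prodMk_right γ))
      (lienardField_zero g (w ^ 2) γ) hy hyρ hconst
    obtain ⟨x, hx, hxγ, t, hyt⟩ := exhausts γ y hγ
      ((isIntegralCurve_lienardField_congr hGg hyρ).2 hy) hy0 hper
    refine ⟨x, ⟨hx, ?_⟩, hxγ, t, hyt⟩
    calc x ≤ ‖y t 0‖ := by simpa [hyt] using le_abs_self x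
      _ ≤ ‖y t‖ := norm_le_pi_norm (y t) 0
      _ < _ := hyr t

theorem isHopfBifurcation_lienardField (hg : ContDiff ℝ (⊤ : ℕ∞) g) (hg0 : g 0 = 0) (hw : 0 < w) :
    IsHopfBifurcation (lienardField g (w ^ 2)) 0 0 w := by
  have hg₁ : ContDiff ℝ 1 g := hg.of_le (by exact_mod_cast le_top)
  have hg' : DifferentiableAt ℝ g 0 := hg₁.differentiable one_ne_zero 0
  obtain ⟨ε₀, hε₀, μ, T, Y, hμ, hT, hμ0, hT0, hY0, hY, exhausts⟩ :=
    exists_periodicOrbit_family_lienardField hg₁ hg0 hw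
  have continuous_initial : Continuous fun x => Y x 0 := by
    simp only [hY0]
    fun_prop
  exact {
    smooth := contDiff_lienardField hg _
    equilibrium := .of_forall fun γ => lienardField_zero g _ γ
    frequency_pos := hw
    eigenvalues := complexEigenvalues_eq_of_trace_eq_zero
      (by rw [trace_jacobian_lienardField_zero hg' hg0, mul_zero])
      (det_jacobian_lienardField_zero hg' hg0 _ 0)
    transversality := exists_eigenvalue_crossing_lienardField hg' hg0 hw
    stability_exchange := Or.inl
      ⟨eventually_mem_nhdsWithin.mono fun γ hγ =>
        isAsymptoticallyStable_lienardField_zero hg' hg0 (pow_pos hw 2) hγ,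
      eventually_mem_nhdsWithin.mono fun γ hγ =>
        isRepelling_lienardField_zero hg' hg0 (pow_pos hw 2) hγ⟩
    periodic_orbits := by
      refine ⟨ε₀, μ, T, Y, hε₀, hμ.continuousOn, hT.continuousOn, continuous_initial.continuousOn,
        hμ0, hT0, by simp [hY0], fun x hx => ⟨(hY x hx).1, (hY x hx).2.1⟩, fun r hr => ?_,
        ε₀, hε₀, w / 32, by positivity, fun γ y hγ hy hper hconst hyr => ?_⟩
      · have hsmall : ∀ᶠ x in 𝓝[>] (0 : ℝ), max 1 w * (Real.exp 1 * x) < r :=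
          Tendsto.eventually_lt_const (v := 0) (by simpa using hr)
            (Continuous.tendsto' (by fun_prop) 0 0 (by simp) |>.mono_left nhdsWithin_le_nhds)
        filter_upwards [hsmall, Ioo_mem_nhdsGT hε₀] with x hxr hx t
        rw [dist_zero_right]
        exact ((hY x hx).2.2 t).trans_lt hxr
      · simp only [dist_zero_right] at hyr
        obtain ⟨x, hx, hμx, hmem⟩ := exhausts γ y (by simpa using hγ.le) hy hper hconst hyr
        exact ⟨x, hx, hμx, by rwa [hY0]⟩ }

end HopfBifurcation

theorem mainTheorem5_general {g : ℝ → ℝ} (hg : ContDiff ℝ (⊤ : ℕ∞) g) (hg0 : g 0 = 0) {k : ℝ}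
    (hk : 0 < k) :
    (∀ γ : ℝ, jacobian (lienardField g k γ) 0 = !![0, 1; -k, 2 * γ]) ∧
    (∀ γ : ℝ, (jacobian (lienardField g k γ) 0).trace = 2 * γ) ∧
    (∀ γ : ℝ, (jacobian (lienardField g k γ) 0).det = k) ∧
    HasDerivAt (fun γ : ℝ => (jacobian (lienardField g k γ) 0).trace) 2 0 ∧
    IsHopfBifurcation (lienardField g k) 0 0 (√k) := by
  have hg' : DifferentiableAt ℝ g 0 := (hg.differentiable (by simp)) 0
  have trace_eq := trace_jacobian_lienardField_zero hg' hg0 k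
  refine ⟨jacobian_lienardField_zero hg' hg0 k, trace_eq, det_jacobian_lienardField_zero hg' hg0 k,
    ?_, ?_⟩
  · simpa only [trace_eq, mul_one] using (hasDerivAt_id' (0 : ℝ)).const_mul 2
  · simpa only [Real.sq_sqrt hk.le] using
      isHopfBifurcation_lienardField hg hg0 (Real.sqrt_pos.2 hk)

theorem mainTheorem5 (a b E : ℝ) (ha : 0 < a) (hb : 0 < b) (hE : 0 < E) :
    (∀ γ : ℝ, jacobian (phaseField a b E γ) 0 = !![0, 1; -2 * E, 2 * γ]) ∧
    (∀ γ : ℝ, (jacobian (phaseField a b E γ) 0).trace = 2 * γ) ∧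
    (∀ γ : ℝ, (jacobian (phaseField a b E γ) 0).det = 2 * E) ∧
    0 < 2 * E ∧
    HasDerivAt (fun γ : ℝ => (jacobian (phaseField a b E γ) 0).trace) 2 0 ∧
    IsHopfBifurcation (phaseField a b E) 0 0 (Real.sqrt (2 * E)) := by
  simpa only [phaseField_eq_lienardField, neg_mul, mul_pos two_pos hE, true_and] using
    mainTheorem5_general (g := fun x => a * x ^ 2 - b * (x ^ 2) ^ 2) (by fun_prop) (by simp)
      (mul_pos two_pos hE)
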